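/- Let $n\ge 2$ and let $\Omega$ be the unit ball $B_n=\{z\in\mathbb C^n:\sum_j|z_j|^2<1\}$ or the unit polydisc $\mathbb D^n$; correspondingly let $\partial\Omega$ denote the unit sphere $S_n$ or the torus $\mathbb T^n$. Let $C(z,w)=(1-\sum_j z_j\overline{w_j})^{-n}$ for the ball and $C(z,w)=\prod_{j=1}^n(1-z_j\overline{w_j})^{-1}$ for the polydisc, and let $P(z,\zeta)=C(z,\zeta)C(\zeta,z)/C(z,z)$ for $z\in\Omega$, $\zeta\in\partial\Omega$. Let $b:\Omega\to\mathbb D$ be a non-constant holomorphic function and let $\alpha\in\mathbb C$, $|\alpha|=1$. Then: (a) The kernel $k_b(z,w)=(1-b(z)\overline{b(w)})\,C(z,w)$ on $\Omega$ is positive semidefinite, and so it is the reproducing kernel of a Hilbert space $\mathcal H(b)$ of functions on $\Omega$ (the de Branges–Rovnyak space). (b) There is a finite positive Borel measure $\sigma_\alpha=\sigma_\alpha[b]$ on $\partial\Omega$ (a Clark measure) such that $$\int_{\partial\Omega}P(z,\zeta)\,d\sigma_\alpha(\zeta)=\operatorname{Re}\frac{\alpha+b(z)}{\alpha-b(z)},\qquad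 z\in\Omega.$$ (c) For every measure $\sigma_\alpha$ as in (b), let $H^2(\sigma_\alpha)$ denote the closed linear span of the functions $C(\cdot,w)$, $w\in\Omega$, in $L^2(\sigma_\alpha)$. Then there is a unique unitary operator $U_{b,\alpha}$ from $\mathcal H(b)$ onto $H^2(\sigma_\alpha)$ such that $$U_{b,\alpha}\,k_b(\cdot,w)=(1-\alpha\overline{b(w)})\,C(\cdot,w)\qquad\text{for all } w\in\Omega.$$ -/

import Mathlib

open MeasureTheory ComplexConjugate

noncomputable section

namespace Clark

/-- The two families of domains under consideration: unit balls and unit polydiscs. -/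
inductive DomainKind : Type
  | ball
  | polydisc

/-- The domain `Ω ⊂ ℂⁿ`: the open Euclidean unit ball or the open unit polydisc. -/
def domain (D : DomainKind) (n : ℕ) : Set (EuclideanSpace ℂ (Fin n)) :=
  match D with
  | .ball => {z | ‖z‖ < 1}
  | .polydisc => {z | ∀ j, ‖z j‖ < 1}

/-- The set denoted `∂Ω`: the unit sphere for the ball, the (distinguished boundary) unit torus
for the polydisc. -/
def boundary (D : DomainKind) (n : ℕ) : Set (EuclideanSpace ℂ (Fin n)) :=
  match D with
  | .ball => {ζ | ‖ζ‖ = 1}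
  | .polydisc => {ζ | ∀ j, ‖ζ j‖ = 1}

/-- The Cauchy kernel `C(z, w)`: `(1 - ⟨z, w⟩)⁻ⁿ` for the ball, where `⟨z, w⟩ = ∑ j, z j * conj (w j)`,
and `∏ j, (1 - z j * conj (w j))⁻¹` for the polydisc. -/
def cauchyKernel (D : DomainKind) {n : ℕ} (z w : EuclideanSpace ℂ (Fin n)) : ℂ :=
  match D with
  | .ball => 1 / (1 - ∑ j, z j * conj (w j)) ^ n
  | .polydisc => ∏ j, 1 / (1 - z j * conj (w j))

/-- The Poisson kernel `P(z, ζ) = C(z, ζ) C(ζ, z) / C(z, z)`. -/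
def poissonKernel (D : DomainKind) {n : ℕ} (z ζ : EuclideanSpace ℂ (Fin n)) : ℂ :=
  cauchyKernel D z ζ * cauchyKernel D ζ z / cauchyKernel D z z

/-- The finite positive Borel measure `σ` on `∂Ω` is the Clark measure `σ_α[b]`:
`P[σ](z) = Re ((α + b z) / (α - b z))` for all `z ∈ Ω`. -/
def IsClarkMeasure (D : DomainKind) {n : ℕ} (b : EuclideanSpace ℂ (Fin n) → ℂ) (α : ℂ)
    (σ : Measure (boundary D n)) : Prop :=
  IsFiniteMeasure σ ∧
    ∀ z ∈ domain D n,
      ∫ ζ : boundary D n, poissonKernel D z ζ ∂σ = (((α + b z) / (α - b z)).re : ℂ)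

/-- The kernel `k_b(z, w) = (1 - b z * conj (b w)) C(z, w)` on `Ω`, written as a matrix of operators
on `ℂ` (multiplication by the scalar `k_b(z, w)`). -/
def dbrKernel (D : DomainKind) {n : ℕ} (b : EuclideanSpace ℂ (Fin n) → ℂ) :
    Matrix (domain D n) (domain D n) (ℂ →L[ℂ] ℂ) :=
  Matrix.of fun z w =>
    ((1 - b z * conj (b w)) * cauchyKernel D (z : EuclideanSpace ℂ (Fin n)) w) •
      ContinuousLinearMap.id ℂ ℂ

/-- The de Branges–Rovnyak space `ℋ(b)`: the Hilbert space of functions on `Ω` with reproducing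
kernel `k_b` (which exists when `k_b` is positive semidefinite). -/
abbrev DBRSpace (D : DomainKind) {n : ℕ} (b : EuclideanSpace ℂ (Fin n) → ℂ)
    [Fact (dbrKernel D b).PosSemidef] : Type :=
  RKHS.OfKernel (dbrKernel D b)

/-- The kernel function `k_b(·, w)` as an element of `ℋ(b)`. -/
def dbrKernelFun (D : DomainKind) {n : ℕ} (b : EuclideanSpace ℂ (Fin n) → ℂ)
    [Fact (dbrKernel D b).PosSemidef] (w : domain D n) : DBRSpace D b :=
  RKHS.kerFun (DBRSpace D b) w 1

theorem dbrKernelFun_apply (D : DomainKind) {n : ℕ} (b : EuclideanSpace ℂ (Fin n) → ℂ)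
    [Fact (dbrKernel D b).PosSemidef] (w z : domain D n) :
    dbrKernelFun D b w z =
      (1 - b z * conj (b w)) * cauchyKernel D (z : EuclideanSpace ℂ (Fin n)) w := by
  rw [dbrKernelFun, RKHS.kerFun_apply, RKHS.OfKernel.kernel_ofKernel]
  simp [dbrKernel]

theorem isCompact_boundary (D : DomainKind) (n : ℕ) : IsCompact (boundary D n) := by
  cases D with
  | ball =>
    have h : boundary .ball n = Metric.sphere (0 : EuclideanSpace ℂ (Fin n)) 1 := by
      ext ζ; simp [boundary]
    rw [h]
    exact isCompact_sphere 0 1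
  | polydisc =>
    refine Metric.isCompact_of_isClosed_isBounded ?_ ?_
    · have h : boundary .polydisc n = ⋂ j, {ζ : EuclideanSpace ℂ (Fin n) | ‖ζ j‖ = 1} := by
        ext ζ; simp [boundary]
      rw [h]
      exact isClosed_iInter fun j => isClosed_eq (by fun_prop) continuous_const
    · refine isBounded_iff_forall_norm_le.2 ⟨√n, fun ζ hζ => ?_⟩
      have hζ' : ∀ j, ‖ζ j‖ = 1 := hζ
      simp [EuclideanSpace.norm_eq, hζ']

instance (D : DomainKind) (n : ℕ) : CompactSpace (boundary D n) :=
  isCompact_iff_compactSpace.1 (isCompact_boundary D n)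

theorem continuous_cauchyKernel (D : DomainKind) {n : ℕ} (w : domain D n) :
    Continuous fun ζ : boundary D n => cauchyKernel D (ζ : EuclideanSpace ℂ (Fin n)) w := by
  cases D with
  | ball =>
    have key : ∀ ζ : boundary .ball n,
        1 - ∑ j, (ζ : EuclideanSpace ℂ (Fin n)) j *
          conj ((w : EuclideanSpace ℂ (Fin n)) j) ≠ 0 := by
      rintro ⟨ζ, hζ⟩ h0
      have hζ' : ‖ζ‖ = 1 := hζ
      have hw : ‖(w : EuclideanSpace ℂ (Fin n))‖ < 1 := w.2
      have h1 : inner ℂ (w : EuclideanSpace ℂ (Fin n)) ζ = 1 := by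
        rw [PiLp.inner_apply]
        simpa [RCLike.inner_apply] using (sub_eq_zero.1 h0).symm
      have h2 := norm_inner_le_norm (𝕜 := ℂ) (w : EuclideanSpace ℂ (Fin n)) ζ
      rw [h1, hζ'] at h2
      simp at h2
      linarith
    simp only [cauchyKernel]
    exact Continuous.div continuous_const (by fun_prop) fun ζ => pow_ne_zero n (key ζ)
  | polydisc =>
    have key : ∀ (ζ : boundary .polydisc n) (j : Fin n),
        1 - (ζ : EuclideanSpace ℂ (Fin n)) j *
          conj ((w : EuclideanSpace ℂ (Fin n)) j) ≠ 0 := by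
      rintro ⟨ζ, hζ⟩ j h0
      have hζ' : ‖ζ j‖ = 1 := hζ j
      have hw : ‖(w : EuclideanSpace ℂ (Fin n)) j‖ < 1 := w.2 j
      have h1 : ‖ζ j * conj ((w : EuclideanSpace ℂ (Fin n)) j)‖ = 1 := by
        rw [← sub_eq_zero.1 h0]; simp
      rw [norm_mul, hζ', RCLike.norm_conj] at h1
      linarith
    simp only [cauchyKernel]
    exact continuous_finsetProd _ fun j _ =>
      Continuous.div continuous_const (by fun_prop) fun ζ => key ζ j

/-- The function `C(·, w)`, `w ∈ Ω`, as an element of `L²(σ)`. -/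
def cauchyL2 (D : DomainKind) {n : ℕ} (σ : Measure (boundary D n)) [IsFiniteMeasure σ]
    (w : domain D n) : Lp ℂ 2 σ :=
  ContinuousMap.toLp 2 σ ℂ ⟨_, continuous_cauchyKernel D w⟩

/-- The space `H²(σ)`: the closed linear span of `C(·, w)`, `w ∈ Ω`, in `L²(σ)`. -/
def H2 (D : DomainKind) {n : ℕ} (σ : Measure (boundary D n)) [IsFiniteMeasure σ] :
    Submodule ℂ (Lp ℂ 2 σ) :=
  (Submodule.span ℂ (Set.range (cauchyL2 D σ))).topologicalClosure

end Clark

end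

noncomputable section

namespace Clark

/-! ### Domains and kernels -/

section DomainFacts

variable {n : ℕ}

/-! Everything rests on one identity. On multiplying the equation in (b) by `C(z,z)` it becomes `∫
|C(z,ζ)|² dσ = C(z,z) (1 - |b(z)|²) / |1 - conj α b(z)|²`. Both sides are diagonal values of
functions holomorphic in `z` and antiholomorphic in a second variable `w`, so they agree off the
diagonal (`polarization`, `integral_cauchyKernel_mul`). Thus the vectors `(1 - α conj (b w)) C(·,w)`
in `L²(σ)` have Gram matrix `k_b`. This gives (a), since Gram matrices are positive semidefinite,
and (c), since two total families with equal Gram matrices are matched by exactly one unitary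
(`existsUnique_linearIsometryEquiv`).

It remains to find a Clark measure. The function `f = (α + b)/(α - b)` is holomorphic with positive
real part. If `m` is a probability measure on `∂Ω` with the Cauchy formula for dilations, the
positive measures `Re f(rζ) dm(ζ)` all have mass `Re f(0)` and Poisson integral `Re f(rz)` wherever
`z/r ∈ Ω`; a weak limit as `r → 1` is the required `σ`
(`HasCauchyFormula.exists_integral_poissonKernel_eq`).

The measure `m` is Haar measure on the torus, where the formula follows one coordinate at a time,
and the unitarily invariant measure on the sphere. There, averaging over rotations about the
direction of `z` reduces the formula to one variable, where it follows from the moments of `⟪e, ζ⟫`: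
they are the reciprocals of the Taylor coefficients of `(1 - x)^(-n)`. -/

theorem isOpen_domain (D : DomainKind) (n : ℕ) : IsOpen (domain D n) := by
  cases D with
  | ball => exact isOpen_lt continuous_norm continuous_const
  | polydisc =>
    have h : domain .polydisc n = ⋂ j, {z : EuclideanSpace ℂ (Fin n) | ‖z j‖ < 1} := by
      ext z; simp [domain]
    rw [h]
    exact isOpen_iInter_of_finite fun j => isOpen_lt (by fun_prop) continuous_const

theorem convex_domain (D : DomainKind) (n : ℕ) : Convex ℝ (domain D n) := by
  cases D with
  | ball =>
    have h : domain .ball n = Metric.ball (0 : EuclideanSpace ℂ (Fin n)) 1 := by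
      ext z; simp [domain]
    rw [h]
    exact convex_ball 0 1
  | polydisc =>
    intro x hx y hy a b ha hb hab j
    have hx' : ‖x j‖ < 1 := hx j
    have hy' : ‖y j‖ < 1 := hy j
    have := convex_ball (0 : ℂ) 1 (x := x j) (by simpa using hx') (y := y j) (by simpa using hy')
      ha hb hab
    simpa using this

theorem smul_boundary_mem_domain {D : DomainKind} {c : ℂ} (hc : ‖c‖ < 1)
    {ζ : EuclideanSpace ℂ (Fin n)} (hζ : ζ ∈ boundary D n) : c • ζ ∈ domain D n := by
  cases D with
  | ball =>
    have hζ' : ‖ζ‖ = 1 := hζ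
    change ‖c • ζ‖ < 1
    rwa [norm_smul, hζ', mul_one]
  | polydisc =>
    intro j
    have hζ' : ‖ζ j‖ = 1 := hζ j
    rwa [PiLp.smul_apply, norm_smul, hζ', mul_one]

theorem zero_mem_domain (D : DomainKind) (n : ℕ) :
    (0 : EuclideanSpace ℂ (Fin n)) ∈ domain D n := by
  cases D <;> simp [domain]

theorem sum_mul_conj_eq_inner (z w : EuclideanSpace ℂ (Fin n)) :
    ∑ j, z j * conj (w j) = inner ℂ w z := by
  simp [PiLp.inner_apply, RCLike.inner_apply]

theorem one_sub_inner_ne_zero {z w : EuclideanSpace ℂ (Fin n)} (h : ‖z‖ * ‖w‖ < 1) :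
    1 - ∑ j, z j * conj (w j) ≠ 0 := by
  rw [sum_mul_conj_eq_inner]
  intro h0
  have h2 := norm_inner_le_norm (𝕜 := ℂ) w z
  rw [← sub_eq_zero.1 h0, norm_one] at h2
  linarith

theorem one_sub_mul_conj_ne_zero {z w : ℂ} (h : ‖z‖ * ‖w‖ < 1) : 1 - z * conj w ≠ 0 := by
  intro h0
  have h1 : ‖z * conj w‖ = 1 := by rw [← sub_eq_zero.1 h0]; simp
  rw [norm_mul, RCLike.norm_conj] at h1
  linarith

theorem cauchyKernel_conj (D : DomainKind) (z w : EuclideanSpace ℂ (Fin n)) :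
    conj (cauchyKernel D z w) = cauchyKernel D w z := by
  cases D <;> simp [cauchyKernel, mul_comm]

theorem cauchyKernel_smul_left (D : DomainKind) (c : ℂ) (z w : EuclideanSpace ℂ (Fin n)) :
    cauchyKernel D (c • z) w = cauchyKernel D z (conj c • w) := by
  cases D <;> simp [cauchyKernel, mul_left_comm, mul_assoc]

theorem cauchyKernel_zero_left (D : DomainKind) (w : EuclideanSpace ℂ (Fin n)) :
    cauchyKernel D 0 w = 1 := by
  cases D <;> simp [cauchyKernel]

theorem cauchyKernel_ne_zero {D : DomainKind} {z w : EuclideanSpace ℂ (Fin n)}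
    (hz : z ∈ domain D n) (hw : w ∈ domain D n) : cauchyKernel D z w ≠ 0 := by
  cases D with
  | ball =>
    have hz' : ‖z‖ < 1 := hz
    have hw' : ‖w‖ < 1 := hw
    exact one_div_ne_zero (pow_ne_zero _ (one_sub_inner_ne_zero
      (mul_lt_one_of_nonneg_of_lt_one_left (norm_nonneg _) hz' hw'.le)))
  | polydisc =>
    refine Finset.prod_ne_zero_iff.2 fun j _ => one_div_ne_zero (one_sub_mul_conj_ne_zero ?_)
    have hz' : ‖z j‖ < 1 := hz j
    have hw' : ‖w j‖ < 1 := hw j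
    exact mul_lt_one_of_nonneg_of_lt_one_left (norm_nonneg _) hz' hw'.le

theorem differentiableOn_cauchyKernel {D : DomainKind} {w : EuclideanSpace ℂ (Fin n)}
    (hw : w ∈ domain D n) : DifferentiableOn ℂ (fun z => cauchyKernel D z w) (domain D n) := by
  cases D with
  | ball =>
    have hw' : ‖w‖ < 1 := hw
    intro z hz
    have hz' : ‖z‖ < 1 := hz
    refine DifferentiableAt.differentiableWithinAt ?_
    have hne := pow_ne_zero n (one_sub_inner_ne_zero
      (mul_lt_one_of_nonneg_of_lt_one_left (norm_nonneg _) hz' hw'.le))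
    simp only [cauchyKernel]
    fun_prop (disch := exact hne)
  | polydisc =>
    intro z hz
    refine DifferentiableAt.differentiableWithinAt ?_
    simp only [cauchyKernel]
    refine (HasFDerivAt.finsetProd (𝕜 := ℂ) (u := Finset.univ) (x := z)
      (g := fun j (z : EuclideanSpace ℂ (Fin n)) => 1 / (1 - z j * conj (w j)))
      fun j _ => DifferentiableAt.hasFDerivAt ?_).differentiableAt
    have hz' : ‖z j‖ < 1 := hz j
    have hw' : ‖w j‖ < 1 := hw j
    have hne := one_sub_mul_conj_ne_zero
      (mul_lt_one_of_nonneg_of_lt_one_left (norm_nonneg _) hz' hw'.le)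
    fun_prop (disch := exact hne)

theorem poissonKernel_im (D : DomainKind) (z ζ : EuclideanSpace ℂ (Fin n)) :
    (poissonKernel D z ζ).im = 0 := by
  rw [← Complex.conj_eq_iff_im, poissonKernel, map_div₀, map_mul, cauchyKernel_conj,
    cauchyKernel_conj, cauchyKernel_conj, mul_comm]

/-- The function `ζ ↦ conj (ζ j)` on the boundary. -/
def conjCoord (D : DomainKind) (j : Fin n) : C(boundary D n, ℂ) :=
  ⟨fun ζ => conj ((ζ : EuclideanSpace ℂ (Fin n)) j), by fun_prop⟩

/-- The function `ζ ↦ C(z, ζ)`, as an element of `C(∂Ω)`. -/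
def cauchyMap (D : DomainKind) (z : EuclideanSpace ℂ (Fin n)) : C(boundary D n, ℂ) :=
  match D with
  | .ball => Ring.inverse (1 - ∑ j, z j • conjCoord .ball j) ^ n
  | .polydisc => ∏ j, Ring.inverse (1 - z j • conjCoord .polydisc j)

theorem ringInverse_apply {X : Type*} [TopologicalSpace X] {f : C(X, ℂ)} (hf : IsUnit f) (x : X) :
    Ring.inverse f x = (f x)⁻¹ := by
  have h := congrArg (fun g : C(X, ℂ) => g x) (Ring.mul_inverse_cancel f hf)
  simp only [ContinuousMap.mul_apply, ContinuousMap.one_apply] at h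
  exact eq_inv_of_mul_eq_one_right h

theorem isUnit_one_sub_sum_conjCoord {z : EuclideanSpace ℂ (Fin n)} (hz : z ∈ domain .ball n) :
    IsUnit (1 - ∑ j, z j • conjCoord .ball j : C(boundary .ball n, ℂ)) := by
  rw [ContinuousMap.isUnit_iff_forall_ne_zero]
  rintro ⟨ζ, hζ⟩
  have hz' : ‖z‖ < 1 := hz
  have hζ' : ‖ζ‖ = 1 := hζ
  simpa [conjCoord, ContinuousMap.sum_apply] using
    one_sub_inner_ne_zero (z := z) (w := ζ) (by rwa [hζ', mul_one])

theorem isUnit_one_sub_conjCoord {z : EuclideanSpace ℂ (Fin n)} (hz : z ∈ domain .polydisc n)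
    (j : Fin n) : IsUnit (1 - z j • conjCoord .polydisc j : C(boundary .polydisc n, ℂ)) := by
  rw [ContinuousMap.isUnit_iff_forall_ne_zero]
  rintro ⟨ζ, hζ⟩
  have hz' : ‖z j‖ < 1 := hz j
  have hζ' : ‖ζ j‖ = 1 := hζ j
  simpa [conjCoord] using one_sub_mul_conj_ne_zero (z := z j) (w := ζ j) (by rwa [hζ', mul_one])

theorem cauchyMap_apply {D : DomainKind} {z : EuclideanSpace ℂ (Fin n)} (hz : z ∈ domain D n)
    (ζ : boundary D n) : cauchyMap D z ζ = cauchyKernel D z ζ := by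
  cases D with
  | ball =>
    simp only [cauchyMap, cauchyKernel, ContinuousMap.pow_apply,
      ringInverse_apply (isUnit_one_sub_sum_conjCoord hz)]
    simp [conjCoord, ContinuousMap.sum_apply]
  | polydisc =>
    simp only [cauchyMap, cauchyKernel, ContinuousMap.prod_apply,
      ringInverse_apply (isUnit_one_sub_conjCoord hz _)]
    simp [conjCoord]

/-- Holomorphy of `z ↦ C(z,·)` with values in the Banach algebra `C(∂Ω)` takes the place of
differentiation under the integral sign. The kernel is built from `Ring.inverse`, which is
differentiable at units. -/
theorem differentiableOn_cauchyMap (D : DomainKind) (n : ℕ) :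
    DifferentiableOn ℂ (cauchyMap D (n := n)) (domain D n) := by
  intro z hz
  refine DifferentiableAt.differentiableWithinAt ?_
  cases D with
  | ball =>
    unfold cauchyMap
    have h : DifferentiableAt ℂ (fun z : EuclideanSpace ℂ (Fin n) =>
        (1 - ∑ j, z j • conjCoord .ball j : C(boundary .ball n, ℂ))) z := by fun_prop
    exact (h.inverse (isUnit_one_sub_sum_conjCoord hz)).pow n
  | polydisc =>
    unfold cauchyMap
    refine (HasFDerivAt.finsetProd (𝕜 := ℂ) (u := Finset.univ) (x := z)
      (g := fun j (z : EuclideanSpace ℂ (Fin n)) =>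
        (Ring.inverse (1 - z j • conjCoord .polydisc j) : C(boundary .polydisc n, ℂ)))
      fun j _ => DifferentiableAt.hasFDerivAt ?_).differentiableAt
    have h : DifferentiableAt ℂ (fun z : EuclideanSpace ℂ (Fin n) =>
        (1 - z j • conjCoord .polydisc j : C(boundary .polydisc n, ℂ))) z := by fun_prop
    exact h.inverse (isUnit_one_sub_conjCoord hz j)

end DomainFacts

/-! ### Polarization -/

/-- A function `F` on `Ω × Ω` that is holomorphic in the first variable and antiholomorphic in the
second one vanishes if it vanishes on the diagonal. Only the restrictions of `F` to the complex
curves `t ↦ (a + t c, a + conj t c)` matter. -/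
theorem polarization {E : Type*} [NormedAddCommGroup E] [NormedSpace ℂ E] {Ω : Set E}
    (hΩ : IsOpen Ω) (hconv : Convex ℝ Ω) {F : E → E → ℂ}
    (hF : ∀ a c : E, DifferentiableOn ℂ (fun t : ℂ => F (a + t • c) (a + conj t • c))
      {t | a + t • c ∈ Ω ∧ a + conj t • c ∈ Ω})
    (hdiag : ∀ z ∈ Ω, F z z = 0) {z w : E} (hz : z ∈ Ω) (hw : w ∈ Ω) : F z w = 0 := by
  -- With midpoint `a` and this `c`, the parameter `t = i` gives the pair `(z, w)`, while real `t`
  -- gives diagonal pairs. The slice function vanishes at the real points of `T`, which accumulate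
  -- at `0`, so the identity theorem on the convex set `T` carries the zero to `i`.
  set a : E := (2⁻¹ : ℝ) • z + (2⁻¹ : ℝ) • w with ha
  set c : E := (-Complex.I / 2) • (z - w) with hc
  set T : Set ℂ := {t | a + t • c ∈ Ω ∧ a + conj t • c ∈ Ω} with hT
  have haΩ : a ∈ Ω := hconv hz hw (by norm_num) (by norm_num) (by norm_num)
  have hTo : IsOpen T := by
    refine IsOpen.inter (hΩ.preimage (by fun_prop)) (hΩ.preimage ?_)
    exact continuous_const.add (Complex.continuous_conj.smul continuous_const)
  have hTc : Convex ℝ T := by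
    intro s hs t ht p q hp hq hpq
    have key : ∀ u v : ℂ, a + (p • u + q • v) • c = p • (a + u • c) + q • (a + v • c) := by
      intro u v
      have : a = (p + q) • a := by rw [hpq, one_smul]
      conv_lhs => rw [this]
      simp only [add_smul, smul_add, smul_assoc]
      abel
    refine ⟨?_, ?_⟩
    · rw [key]; exact hconv hs.1 ht.1 hp hq hpq
    · have : conj (p • s + q • t) = p • conj s + q • conj t := by simp
      rw [this, key]; exact hconv hs.2 ht.2 hp hq hpq
  have e1 : a + Complex.I • c = z := by
    have : Complex.I * (-Complex.I / 2) = ((2⁻¹ : ℝ) : ℂ) := by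
      push_cast; linear_combination (-1 / 2 : ℂ) * Complex.I_mul_I
    rw [ha, hc, smul_smul, this, Complex.coe_smul, smul_sub]
    have h2 : z = (2⁻¹ : ℝ) • z + (2⁻¹ : ℝ) • z := by rw [← add_smul]; norm_num
    conv_rhs => rw [h2]
    abel
  have e2 : a + conj Complex.I • c = w := by
    have : conj Complex.I * (-Complex.I / 2) = -((2⁻¹ : ℝ) : ℂ) := by
      rw [Complex.conj_I]; push_cast; linear_combination (1 / 2 : ℂ) * Complex.I_mul_I
    rw [ha, hc, smul_smul, this, neg_smul, Complex.coe_smul, smul_sub]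
    have h2 : w = (2⁻¹ : ℝ) • w + (2⁻¹ : ℝ) • w := by rw [← add_smul]; norm_num
    conv_rhs => rw [h2]
    abel
  have h0T : (0 : ℂ) ∈ T := by simpa [hT] using haΩ
  have hIT : Complex.I ∈ T := by
    refine ⟨?_, ?_⟩
    · rwa [e1]
    · rwa [e2]
  have hreal : ∃ᶠ t in nhdsWithin (0 : ℂ) {0}ᶜ, F (a + t • c) (a + conj t • c) = 0 := by
    have hseq : Filter.Tendsto (fun k : ℕ => ((1 / ((k : ℝ) + 1) : ℝ) : ℂ)) Filter.atTop
        (nhdsWithin (0 : ℂ) {0}ᶜ) := by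
      refine tendsto_nhdsWithin_iff.2 ⟨?_, Filter.Eventually.of_forall fun k => ?_⟩
      · have := (Complex.continuous_ofReal.tendsto 0).comp
          (tendsto_one_div_add_atTop_nhds_zero_nat (𝕜 := ℝ))
        simpa [Function.comp_def] using this
      · simp only [Set.mem_compl_iff, Set.mem_singleton_iff, Complex.ofReal_eq_zero]
        positivity
    have hev := (hseq.mono_right nhdsWithin_le_nhds).eventually (hTo.mem_nhds h0T)
    refine hseq.frequently (Filter.Eventually.frequently ?_)
    filter_upwards [hev] with k hk
    rw [Complex.conj_ofReal]
    exact hdiag _ hk.1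
  have := ((hF a c).analyticOnNhd hTo).eqOn_zero_of_preconnected_of_frequently_eq_zero
    hTc.isPreconnected h0T hreal hIT
  simpa only [e1, e2, Pi.zero_apply] using this

/-! ### Integration against a finite measure on a compact space -/

section IntegralMap

variable {X : Type*} [TopologicalSpace X] [CompactSpace X] [MeasurableSpace X] [BorelSpace X]

theorem integrable_continuousMap (μ : Measure X) [IsFiniteMeasure μ] (f : C(X, ℂ)) :
    Integrable f μ :=
  f.continuous.integrable_of_hasCompactSupport (HasCompactSupport.of_compactSpace f)

/-- Integration against `μ` as a continuous linear functional on `C(X)`. -/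
def integralMap (μ : Measure X) [IsFiniteMeasure μ] : C(X, ℂ) →L[ℂ] ℂ :=
  LinearMap.mkContinuous
    { toFun := fun f => ∫ x, f x ∂μ
      map_add' := fun f g =>
        integral_add (integrable_continuousMap μ f) (integrable_continuousMap μ g)
      map_smul' := fun c f => integral_const_mul c f }
    (μ.real Set.univ) fun f => by
      rw [mul_comm]
      exact norm_integral_le_of_norm_le_const (Filter.Eventually.of_forall f.norm_coe_le_norm)

theorem integralMap_apply (μ : Measure X) [IsFiniteMeasure μ] (f : C(X, ℂ)) :
    integralMap μ f = ∫ x, f x ∂μ := rfl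

end IntegralMap

/-! ### Unitary operators from Gram matrices -/

theorem denseRange_linearCombination {ι G : Type*} [NormedAddCommGroup G] [InnerProductSpace ℂ G]
    {u : ι → G} (hu : (Submodule.span ℂ (Set.range u)).topologicalClosure = ⊤) :
    DenseRange (Finsupp.linearCombination ℂ u) := by
  have := (Submodule.dense_iff_topologicalClosure_eq_top).2 hu
  rwa [← Finsupp.range_linearCombination] at this

/-- Two families with the same Gram matrix and dense spans are related by a unitary operator. -/
theorem existsUnique_linearIsometryEquiv {ι E F : Type*} [NormedAddCommGroup E]
    [InnerProductSpace ℂ E] [CompleteSpace E] [NormedAddCommGroup F] [InnerProductSpace ℂ F]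
    [CompleteSpace F] {v : ι → E} {w : ι → F}
    (hv : (Submodule.span ℂ (Set.range v)).topologicalClosure = ⊤)
    (hw : (Submodule.span ℂ (Set.range w)).topologicalClosure = ⊤)
    (h : ∀ i j, inner ℂ (v i) (v j) = inner ℂ (w i) (w j)) :
    ∃! U : E ≃ₗᵢ[ℂ] F, ∀ i, U (v i) = w i := by
  have hnorm : ∀ c : ι →₀ ℂ, ‖Finsupp.linearCombination ℂ w c‖ =
      ‖Finsupp.linearCombination ℂ v c‖ := by
    intro c
    have : inner ℂ (Finsupp.linearCombination ℂ w c) (Finsupp.linearCombination ℂ w c) =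
        inner ℂ (Finsupp.linearCombination ℂ v c) (Finsupp.linearCombination ℂ v c) := by
      simp only [Finsupp.linearCombination_apply, Finsupp.sum_inner, Finsupp.inner_sum,
        inner_smul_left, inner_smul_right, h]
    rw [inner_self_eq_norm_sq_to_K, inner_self_eq_norm_sq_to_K] at this
    have h2 : ‖Finsupp.linearCombination ℂ w c‖ ^ 2 = ‖Finsupp.linearCombination ℂ v c‖ ^ 2 := by
      exact_mod_cast this
    exact (sq_eq_sq₀ (norm_nonneg _) (norm_nonneg _)).1 h2
  -- By `hnorm`, the assignment `∑ c i • v i ↦ ∑ c i • w i` is well defined and isometric, so it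
  -- extends from a dense subspace. Its range is closed by completeness and dense by `hw`.
  set A : E →L[ℂ] F :=
    (Finsupp.linearCombination ℂ w).extendOfNorm (Finsupp.linearCombination ℂ v) with hA
  have hAe : ∀ c, A (Finsupp.linearCombination ℂ v c) = Finsupp.linearCombination ℂ w c :=
    LinearMap.extendOfNorm_eq (denseRange_linearCombination hv) ⟨1, fun c => by rw [hnorm, one_mul]⟩
  have hAn : ∀ x, ‖A x‖ = ‖x‖ := fun x =>
    (denseRange_linearCombination hv).induction_on (p := fun x => ‖A x‖ = ‖x‖) x
      (isClosed_eq (by fun_prop) (by fun_prop)) fun c => by rw [hAe, hnorm]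
  let Ai : E →ₗᵢ[ℂ] F := ⟨A.toLinearMap, hAn⟩
  have hsurj : Function.Surjective Ai := by
    have hcl : IsClosed (Set.range Ai) := Ai.isometry.isClosedEmbedding.isClosed_range
    have hd : DenseRange Ai := by
      refine (denseRange_linearCombination hw).mono ?_
      rintro _ ⟨c, rfl⟩
      exact ⟨_, hAe c⟩
    exact Set.range_eq_univ.1 (hcl.closure_eq ▸ hd.closure_range)
  have hAv : ∀ i, A (v i) = w i := fun i => by
    simpa using hAe (Finsupp.single i 1)
  refine ⟨LinearIsometryEquiv.ofSurjective Ai hsurj, hAv, fun U hU => ?_⟩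
  ext x
  refine (denseRange_linearCombination hv).induction_on (p := fun x => U x = A x) x
    (isClosed_eq (by fun_prop) (by fun_prop)) fun c => ?_
  simp only [Finsupp.linearCombination_apply, Finsupp.sum, map_sum, map_smul, hU, hAv]

/-! ### Gram matrices of Cauchy kernels with respect to a Clark measure -/

section ClarkGram

variable {D : DomainKind} {n : ℕ} {b : EuclideanSpace ℂ (Fin n) → ℂ} {α : ℂ}
  {σ : Measure (boundary D n)}

theorem sub_ne_zero_of_norm_lt {α β : ℂ} (hα : ‖α‖ = 1) (hβ : ‖β‖ < 1) : α - β ≠ 0 := by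
  intro h
  rw [sub_eq_zero.1 h] at hα
  linarith

theorem one_sub_mul_conj_ne_zero_of_norm_eq_one {α β : ℂ} (hα : ‖α‖ = 1) (hβ : ‖β‖ < 1) :
    1 - α * conj β ≠ 0 :=
  one_sub_mul_conj_ne_zero (by rwa [hα, one_mul])

/-- The real part is `(1 - |β|²)/|α - β|²`. The denominator is factored so that one factor is
holomorphic in `β` and the other antiholomorphic, which is the form needed for polarization. -/
theorem re_cayley_eq {α β : ℂ} (hα : ‖α‖ = 1) (hβ : ‖β‖ < 1) :
    (((α + β) / (α - β)).re : ℂ) * ((1 - conj α * β) * (1 - α * conj β)) = 1 - β * conj β := by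
  have h1 := sub_ne_zero_of_norm_lt hα hβ
  have h2 : conj α - conj β ≠ 0 := by
    rw [← map_sub]; exact (map_ne_zero _).2 h1
  have hα' : α * conj α = 1 := by rw [Complex.mul_conj, Complex.normSq_eq_norm_sq, hα]; simp
  have hprod : (1 - conj α * β) * (1 - α * conj β) = (α - β) * (conj α - conj β) := by
    linear_combination (β * conj β - 1) * hα'
  rw [Complex.re_eq_add_conj, hprod]
  simp only [map_div₀, map_add, map_sub]
  field_simp
  linear_combination 2 * hα'

theorem re_cayley_pos {α β : ℂ} (hα : ‖α‖ = 1) (hβ : ‖β‖ < 1) : 0 < ((α + β) / (α - β)).re := by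
  have h1 := sub_ne_zero_of_norm_lt hα hβ
  have h := re_cayley_eq hα hβ
  have e1 : (1 - conj α * β) * (1 - α * conj β) = ((‖1 - α * conj β‖ ^ 2 : ℝ) : ℂ) := by
    rw [← Complex.normSq_eq_norm_sq, ← Complex.mul_conj]
    simp [mul_comm]
  have e2 : 1 - β * conj β = ((1 - ‖β‖ ^ 2 : ℝ) : ℂ) := by
    rw [Complex.mul_conj, Complex.normSq_eq_norm_sq]; simp
  rw [e1, e2] at h
  have h' : ((α + β) / (α - β)).re * ‖1 - α * conj β‖ ^ 2 = 1 - ‖β‖ ^ 2 := by exact_mod_cast h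
  have h3 : 0 < ‖1 - α * conj β‖ ^ 2 := by
    have := norm_pos_iff.2 (one_sub_mul_conj_ne_zero_of_norm_eq_one hα hβ)
    positivity
  have h4 : 0 < 1 - ‖β‖ ^ 2 := by nlinarith [norm_nonneg β]
  rw [← h'] at h4
  exact (pos_iff_pos_of_mul_pos h4).2 h3

/-- The kernel conjugates its second argument, which undoes the `conj t`; along the curve it is a
rational function of `t`. -/
theorem differentiableAt_cauchyKernel_line {a c : EuclideanSpace ℂ (Fin n)} {t : ℂ}
    (h1 : a + t • c ∈ domain D n) (h2 : a + conj t • c ∈ domain D n) :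
    DifferentiableAt ℂ (fun t : ℂ => cauchyKernel D (a + t • c) (a + conj t • c)) t := by
  cases D with
  | ball =>
    have h1' : ‖a + t • c‖ < 1 := h1
    have h2' : ‖a + conj t • c‖ < 1 := h2
    have hne := pow_ne_zero n (one_sub_inner_ne_zero
      (mul_lt_one_of_nonneg_of_lt_one_left (norm_nonneg _) h1' h2'.le))
    simp only [cauchyKernel, PiLp.add_apply, PiLp.smul_apply, smul_eq_mul, map_add, map_mul,
      Complex.conj_conj] at hne ⊢
    fun_prop (disch := exact hne)
  | polydisc =>
    simp only [cauchyKernel]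
    refine (HasFDerivAt.finsetProd (𝕜 := ℂ) (u := Finset.univ) (x := t)
      (g := fun j t => 1 / (1 - (a + t • c) j * conj ((a + conj t • c) j)))
      fun j _ => DifferentiableAt.hasFDerivAt ?_).differentiableAt
    have h1' : ‖(a + t • c) j‖ < 1 := h1 j
    have h2' : ‖(a + conj t • c) j‖ < 1 := h2 j
    have hne := one_sub_mul_conj_ne_zero
      (mul_lt_one_of_nonneg_of_lt_one_left (norm_nonneg _) h1' h2'.le)
    simp only [PiLp.add_apply, PiLp.smul_apply, smul_eq_mul, map_add, map_mul,
      Complex.conj_conj] at hne ⊢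
    fun_prop (disch := exact hne)

/-- The key identity: for `z = w` it is the defining equation of a Clark measure cleared of
denominators, and polarization gives the rest. -/
theorem integral_cauchyKernel_mul [IsFiniteMeasure σ]
    (hb : DifferentiableOn ℂ b (domain D n)) (hb_disc : ∀ z ∈ domain D n, ‖b z‖ < 1)
    (hα : ‖α‖ = 1) (hσ : IsClarkMeasure D b α σ) {z w : EuclideanSpace ℂ (Fin n)}
    (hz : z ∈ domain D n) (hw : w ∈ domain D n) :
    (∫ ζ : boundary D n, cauchyKernel D z ζ * cauchyKernel D ζ w ∂σ) *
      ((1 - conj α * b z) * (1 - α * conj (b w))) =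
      (1 - b z * conj (b w)) * cauchyKernel D z w := by
  have hint : ∀ u ∈ domain D n, ∀ v ∈ domain D n,
      ∫ ζ : boundary D n, cauchyKernel D u ζ * cauchyKernel D ζ v ∂σ =
        integralMap σ (cauchyMap D u * star (cauchyMap D v)) := by
    intro u hu v hv
    rw [integralMap_apply]
    refine integral_congr_ae (Filter.Eventually.of_forall fun ζ => ?_)
    simp only [ContinuousMap.mul_apply, ContinuousMap.star_apply, cauchyMap_apply hu,
      cauchyMap_apply hv]
    rw [← cauchyKernel_conj D v ζ]; rfl
  rw [hint z hz w hw, ← sub_eq_zero]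
  refine polarization (isOpen_domain D n) (convex_domain D n)
    (F := fun z w => integralMap σ (cauchyMap D z * star (cauchyMap D w)) *
      ((1 - conj α * b z) * (1 - α * conj (b w))) - (1 - b z * conj (b w)) * cauchyKernel D z w)
    ?_ ?_ hz hw
  · intro a c t ht
    refine DifferentiableAt.differentiableWithinAt ?_
    have hl : ∀ s, DifferentiableAt ℂ (fun t : ℂ => a + t • c) s := fun s => by fun_prop
    have hb' : ∀ u ∈ domain D n, DifferentiableAt ℂ b u := fun u hu =>
      (hb u hu).differentiableAt ((isOpen_domain D n).mem_nhds hu)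
    have hΦ' : ∀ u ∈ domain D n, DifferentiableAt ℂ (cauchyMap D (n := n)) u := fun u hu =>
      (differentiableOn_cauchyMap D n u hu).differentiableAt ((isOpen_domain D n).mem_nhds hu)
    have h1 : DifferentiableAt ℂ (fun t : ℂ => b (a + t • c)) t :=
      (hb' _ ht.1).comp t (hl t)
    -- Conjugating both the variable and the value of a holomorphic function gives a holomorphic
    -- function.
    have h2 : DifferentiableAt ℂ (fun t : ℂ => conj (b (a + conj t • c))) t := by
      have : DifferentiableAt ℂ (fun t : ℂ => b (a + t • c)) (conj t) :=
        (hb' _ ht.2).comp (conj t) (hl _)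
      have h := this.conj_conj
      rwa [Complex.conj_conj] at h
    have h3 : DifferentiableAt ℂ (fun t : ℂ => cauchyMap D (a + t • c)) t :=
      (hΦ' _ ht.1).comp t (f := fun t : ℂ => a + t • c) (hl t)
    have h4 : DifferentiableAt ℂ (fun t : ℂ => star (cauchyMap D (a + conj t • c))) t := by
      have : DifferentiableAt ℂ (fun t : ℂ => cauchyMap D (a + t • c)) (conj t) :=
        (hΦ' _ ht.2).comp (conj t) (f := fun t : ℂ => a + t • c) (hl _)
      have h := this.star_star
      rwa [← starRingEnd_apply, Complex.conj_conj] at h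
    have h5 : DifferentiableAt ℂ (fun t : ℂ => cauchyKernel D (a + t • c) (a + conj t • c)) t :=
      differentiableAt_cauchyKernel_line ht.1 ht.2
    have h6 := (integralMap σ).differentiableAt.comp t (h3.mul h4)
    exact (h6.mul (((differentiableAt_const _).sub ((differentiableAt_const _).mul h1)).mul
      ((differentiableAt_const _).sub ((differentiableAt_const _).mul h2)))).sub
      (((differentiableAt_const _).sub (h1.mul h2)).mul h5)
  · intro u hu
    have hP := hσ.2 u hu
    simp only [poissonKernel] at hP
    rw [integral_div, hint u hu u hu, div_eq_iff (cauchyKernel_ne_zero hu hu)] at hP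
    rw [hP, sub_eq_zero, ← re_cayley_eq hα (hb_disc u hu)]
    ring

theorem inner_cauchyL2 [IsFiniteMeasure σ] (z w : domain D n) :
    inner ℂ (cauchyL2 D σ z) (cauchyL2 D σ w) =
      ∫ ζ : boundary D n, cauchyKernel D (z : EuclideanSpace ℂ (Fin n)) ζ *
        cauchyKernel D (ζ : EuclideanSpace ℂ (Fin n)) w ∂σ := by
  rw [cauchyL2, cauchyL2, ContinuousMap.inner_toLp]
  refine integral_congr_ae (Filter.Eventually.of_forall fun ζ => ?_)
  simp [cauchyKernel_conj, mul_comm]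

theorem inner_smul_cauchyL2 [IsFiniteMeasure σ]
    (hb : DifferentiableOn ℂ b (domain D n)) (hb_disc : ∀ z ∈ domain D n, ‖b z‖ < 1)
    (hα : ‖α‖ = 1) (hσ : IsClarkMeasure D b α σ) (z w : domain D n) :
    inner ℂ ((1 - α * conj (b z)) • cauchyL2 D σ z) ((1 - α * conj (b w)) • cauchyL2 D σ w) =
      (1 - b z * conj (b w)) * cauchyKernel D (z : EuclideanSpace ℂ (Fin n)) w := by
  rw [← integral_cauchyKernel_mul hb hb_disc hα hσ z.2 w.2, inner_smul_left, inner_smul_right,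
    inner_cauchyL2]
  simp only [map_sub, map_one, map_mul, Complex.conj_conj]
  ring

/-- The quadratic form of `k_b` is the squared norm of a combination of the vectors `x z` in
`L²(σ)`; positivity is thus drawn from a Clark measure. -/
theorem dbrKernel_posSemidef [IsFiniteMeasure σ]
    (hb : DifferentiableOn ℂ b (domain D n)) (hb_disc : ∀ z ∈ domain D n, ‖b z‖ < 1)
    (hα : ‖α‖ = 1) (hσ : IsClarkMeasure D b α σ) : (dbrKernel D b).PosSemidef := by
  have key := (RKHS.posSemidef_tfae (K := dbrKernel D b)).out 0 2
  refine key.2 ⟨?_, fun v => ?_⟩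
  · refine Matrix.IsHermitian.ext fun z w => ?_
    refine ContinuousLinearMap.ext_ring ?_
    have hid : star (ContinuousLinearMap.id ℂ ℂ) = ContinuousLinearMap.id ℂ ℂ :=
      star_one (ℂ →L[ℂ] ℂ)
    simp [dbrKernel, cauchyKernel_conj, mul_comm, hid]
  · set x : domain D n → Lp ℂ 2 σ := fun z => (1 - α * conj (b z)) • cauchyL2 D σ z with hx
    have h : (v.sum fun z c => v.sum fun w d => inner ℂ (dbrKernel D b w z c) d) =
        inner ℂ (v.sum fun z c => c • x z) (v.sum fun z c => c • x z) := by
      rw [Finsupp.sum_comm]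
      simp only [Finsupp.sum_inner, Finsupp.inner_sum, inner_smul_left, inner_smul_right,
        Finsupp.mul_sum]
      refine Finsupp.sum_congr fun z _ => Finsupp.sum_congr fun w _ => ?_
      simp only [hx, inner_smul_cauchyL2 hb hb_disc hα hσ]
      simp [dbrKernel, cauchyKernel_conj]
      exact Or.inl (by ring)
    rw [h]
    exact inner_self_nonneg

theorem closure_span_dbrKernelFun [Fact (dbrKernel D b).PosSemidef] :
    (Submodule.span ℂ (Set.range (dbrKernelFun D b))).topologicalClosure = ⊤ := by
  rw [← RKHS.kerFun_dense (H := DBRSpace D b)]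
  congr 1
  refine le_antisymm (Submodule.span_mono ?_) (Submodule.span_le.2 ?_)
  · rintro _ ⟨w, rfl⟩
    exact ⟨w, 1, rfl⟩
  · rintro _ ⟨w, v, rfl⟩
    have : RKHS.kerFun (DBRSpace D b) w v = v • dbrKernelFun D b w := by
      rw [dbrKernelFun, ← map_smul, smul_eq_mul, mul_one]
    rw [this]
    exact Submodule.smul_mem _ _ (Submodule.subset_span ⟨w, rfl⟩)

theorem inner_dbrKernelFun [Fact (dbrKernel D b).PosSemidef] (z w : domain D n) :
    inner ℂ (dbrKernelFun D b z) (dbrKernelFun D b w) =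
      (1 - b z * conj (b w)) * cauchyKernel D (z : EuclideanSpace ℂ (Fin n)) w := by
  rw [← dbrKernelFun_apply]
  conv_lhs => rw [dbrKernelFun]
  rw [RKHS.kerFun_inner]
  simp

theorem closure_span_codRestrict {ι G : Type*} [NormedAddCommGroup G] [InnerProductSpace ℂ G]
    (S : Submodule ℂ G) (x : ι → S)
    (h : S = (Submodule.span ℂ (Set.range fun i => (x i : G))).topologicalClosure) :
    (Submodule.span ℂ (Set.range x)).topologicalClosure = ⊤ := by
  rw [← Submodule.dense_iff_topologicalClosure_eq_top]
  intro y
  rw [closure_subtype]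
  have e : (Subtype.val '' (Submodule.span ℂ (Set.range x) : Set S)) =
      (Submodule.span ℂ (Set.range fun i => (x i : G)) : Set G) := by
    have := Submodule.map_span S.subtype (Set.range x)
    rw [← Set.range_comp] at this
    exact congrArg (fun T : Submodule ℂ G => (T : Set G)) this
  rw [e, ← Submodule.topologicalClosure_coe, ← h]
  exact y.2

/-- The factors `1 - α conj (b w)` do not vanish, so the rescaled Cauchy kernels still span `H2 D
σ`, and their Gram matrix is that of the kernel functions of `ℋ(b)`. -/
theorem existsUnique_clarkUnitary [Fact (dbrKernel D b).PosSemidef] [IsFiniteMeasure σ]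
    (hb : DifferentiableOn ℂ b (domain D n)) (hb_disc : ∀ z ∈ domain D n, ‖b z‖ < 1)
    (hα : ‖α‖ = 1) (hσ : IsClarkMeasure D b α σ) :
    ∃! U : DBRSpace D b ≃ₗᵢ[ℂ] H2 D σ, ∀ w : domain D n,
      (U (dbrKernelFun D b w) : Lp ℂ 2 σ) = (1 - α * conj (b w)) • cauchyL2 D σ w := by
  have hmem : ∀ w : domain D n, (1 - α * conj (b w)) • cauchyL2 D σ w ∈ H2 D σ := fun w =>
    Submodule.smul_mem _ _ (Submodule.le_topologicalClosure _ (Submodule.subset_span ⟨w, rfl⟩))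
  have : CompleteSpace (H2 D σ) :=
    (Submodule.isClosed_topologicalClosure _).completeSpace_coe
  set x : domain D n → H2 D σ := fun w => ⟨_, hmem w⟩ with hx
  have hspan : H2 D σ =
      (Submodule.span ℂ (Set.range fun i => (x i : Lp ℂ 2 σ))).topologicalClosure := by
    refine congrArg Submodule.topologicalClosure ?_
    refine le_antisymm (Submodule.span_le.2 ?_) (Submodule.span_le.2 ?_)
    · rintro _ ⟨w, rfl⟩
      have hne := one_sub_mul_conj_ne_zero_of_norm_eq_one hα (hb_disc w w.2)
      have : cauchyL2 D σ w = (1 - α * conj (b w))⁻¹ • (x w : Lp ℂ 2 σ) := by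
        rw [hx, smul_smul, inv_mul_cancel₀ hne, one_smul]
      rw [this]
      exact Submodule.smul_mem _ _ (Submodule.subset_span ⟨w, rfl⟩)
    · rintro _ ⟨w, rfl⟩
      exact Submodule.smul_mem _ _ (Submodule.subset_span ⟨w, rfl⟩)
  have key := existsUnique_linearIsometryEquiv (v := dbrKernelFun D b) (w := x)
    closure_span_dbrKernelFun (closure_span_codRestrict _ x hspan) fun i j => by
      rw [inner_dbrKernelFun, ← inner_smul_cauchyL2 hb hb_disc hα hσ]; rfl
  simpa only [Subtype.ext_iff] using key

end ClarkGram

/-! ### Existence of Clark measures -/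

section Existence

variable {D : DomainKind} {n : ℕ}

/-- The measure `m` on `∂Ω` satisfies the Cauchy formula for the dilations `g(r ·)` of holomorphic
functions `g` on `Ω`. -/
def HasCauchyFormula (m : Measure (boundary D n)) : Prop :=
  ∀ g : EuclideanSpace ℂ (Fin n) → ℂ, DifferentiableOn ℂ g (domain D n) →
    ∀ r : ℝ, 0 < r → r < 1 → ∀ z ∈ domain D n,
      ∫ ζ : boundary D n, cauchyKernel D z ζ * g ((r : ℂ) • (ζ : EuclideanSpace ℂ (Fin n))) ∂m =
        g ((r : ℂ) • z)

theorem continuous_poissonKernel {z : EuclideanSpace ℂ (Fin n)} (hz : z ∈ domain D n) :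
    Continuous fun ζ : boundary D n => poissonKernel D z ζ := by
  have h := continuous_cauchyKernel D ⟨z, hz⟩
  have h' : Continuous fun ζ : boundary D n => cauchyKernel D z ζ := by
    simpa only [Function.comp_def, cauchyKernel_conj] using Complex.continuous_conj.comp h
  exact (h'.mul h).div_const _

theorem ofReal_norm_lt {r : ℝ} (h0 : 0 < r) (h1 : r < 1) : ‖(r : ℂ)‖ < 1 := by
  rwa [Complex.norm_real, Real.norm_of_nonneg h0.le]

theorem continuous_comp_dilation {g : EuclideanSpace ℂ (Fin n) → ℂ}
    (hg : ContinuousOn g (domain D n)) {r : ℝ} (h0 : 0 < r) (h1 : r < 1) :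
    Continuous fun ζ : boundary D n => g ((r : ℂ) • (ζ : EuclideanSpace ℂ (Fin n))) :=
  hg.comp_continuous (by fun_prop) fun ζ => smul_boundary_mem_domain (ofReal_norm_lt h0 h1) ζ.2

/-- The Cauchy formula is applied to `f · C(·, z/r)`, holomorphic on `Ω` by `hzr`: its dilation is
`f(rζ) C(ζ,z)`, with value `f(rz) C(z,z)` at `z`. Dividing by `C(z,z)` gives the Poisson formula,
and real parts may be taken because `P` is real. -/
theorem HasCauchyFormula.integral_poissonKernel {m : Measure (boundary D n)} [IsFiniteMeasure m]
    (hm : HasCauchyFormula m) {f : EuclideanSpace ℂ (Fin n) → ℂ}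
    (hf : DifferentiableOn ℂ f (domain D n)) {r : ℝ} (h0 : 0 < r) (h1 : r < 1)
    {z : EuclideanSpace ℂ (Fin n)} (hz : z ∈ domain D n) (hzr : ((r⁻¹ : ℝ) : ℂ) • z ∈ domain D n) :
    ∫ ζ : boundary D n,
      poissonKernel D z ζ * ((f ((r : ℂ) • (ζ : EuclideanSpace ℂ (Fin n)))).re : ℂ) ∂m =
        (f ((r : ℂ) • z)).re := by
  have hr : (r : ℂ) ≠ 0 := by exact_mod_cast h0.ne'
  have hC : ∀ ζ, cauchyKernel D ((r : ℂ) • ζ) (((r⁻¹ : ℝ) : ℂ) • z) = cauchyKernel D ζ z := by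
    intro ζ
    rw [cauchyKernel_smul_left, Complex.conj_ofReal, smul_smul, Complex.ofReal_inv,
      mul_inv_cancel₀ hr, one_smul]
  have h := hm (fun x => f x * cauchyKernel D x (((r⁻¹ : ℝ) : ℂ) • z))
    (hf.mul (differentiableOn_cauchyKernel hzr)) r h0 h1 z hz
  simp only [hC] at h
  have h2 : ∫ ζ : boundary D n,
      poissonKernel D z ζ * f ((r : ℂ) • (ζ : EuclideanSpace ℂ (Fin n))) ∂m =
        f ((r : ℂ) • z) := by
    rw [← mul_div_cancel_right₀ (f ((r : ℂ) • z)) (cauchyKernel_ne_zero hz hz), ← h,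
      ← integral_div]
    refine integral_congr_ae (Filter.Eventually.of_forall fun ζ => ?_)
    simp only [poissonKernel]
    ring
  have h3 : ∀ ζ : boundary D n,
      poissonKernel D z ζ * ((f ((r : ℂ) • (ζ : EuclideanSpace ℂ (Fin n)))).re : ℂ) =
      ((poissonKernel D z ζ * f ((r : ℂ) • (ζ : EuclideanSpace ℂ (Fin n)))).re : ℂ) := by
    intro ζ
    have hre : poissonKernel D z (ζ : EuclideanSpace ℂ (Fin n)) =
        ((poissonKernel D z (ζ : EuclideanSpace ℂ (Fin n))).re : ℂ) :=
      Complex.ext rfl (poissonKernel_im D z ζ)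
    rw [hre, Complex.re_ofReal_mul]
    push_cast
    rfl
  have hint : Integrable (fun ζ : boundary D n =>
      poissonKernel D z ζ * f ((r : ℂ) • (ζ : EuclideanSpace ℂ (Fin n)))) m :=
    integrable_continuousMap m ⟨_, (continuous_poissonKernel hz).mul
      (continuous_comp_dilation hf.continuousOn h0 h1)⟩
  simp only [h3]
  rw [integral_complex_ofReal, ← h2]
  congr 1
  exact Complex.reCLM.integral_comp_comm hint

/-- A Herglotz-type theorem by weak compactness: `P(0,·) = 1` fixes the mass of the approximating
measures, so they stay in a compact set. -/
theorem HasCauchyFormula.exists_integral_poissonKernel_eq {m : Measure (boundary D n)}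
    [IsFiniteMeasure m] (hm : HasCauchyFormula m) {f : EuclideanSpace ℂ (Fin n) → ℂ}
    (hf : DifferentiableOn ℂ f (domain D n)) (hpos : ∀ z ∈ domain D n, 0 ≤ (f z).re) :
    ∃ σ : Measure (boundary D n), IsFiniteMeasure σ ∧
      ∀ z ∈ domain D n, ∫ ζ : boundary D n, poissonKernel D z ζ ∂σ = ((f z).re : ℂ) := by
  set r : ℕ → ℝ := fun k => 1 - 1 / ((k : ℝ) + 2) with hr
  have hr0 : ∀ k, 0 < r k := by
    intro k
    have : (1 : ℝ) / ((k : ℝ) + 2) < 1 := by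
      rw [div_lt_one (by positivity)]; linarith [(Nat.cast_nonneg k : (0 : ℝ) ≤ k)]
    simp only [hr]; linarith
  have hr1 : ∀ k, r k < 1 := by
    intro k
    have : (0 : ℝ) < 1 / ((k : ℝ) + 2) := by positivity
    simp only [hr]; linarith
  have hrlim : Filter.Tendsto r Filter.atTop (nhds 1) := by
    have h1 : Filter.Tendsto (fun k : ℕ => (k : ℝ) + 2) Filter.atTop Filter.atTop :=
      Filter.tendsto_atTop_add_const_right _ _ tendsto_natCast_atTop_atTop
    simpa [hr, one_div] using h1.inv_tendsto_atTop.const_sub 1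
  set u : ℕ → boundary D n → ℝ := fun k ζ =>
    (f ((r k : ℂ) • (ζ : EuclideanSpace ℂ (Fin n)))).re with hu
  have huc : ∀ k, Continuous (u k) := fun k =>
    Complex.continuous_re.comp (continuous_comp_dilation hf.continuousOn (hr0 k) (hr1 k))
  have hu0 : ∀ k ζ, 0 ≤ u k ζ := fun k ζ =>
    hpos _ (smul_boundary_mem_domain (ofReal_norm_lt (hr0 k) (hr1 k)) ζ.2)
  set ν : ℕ → Measure (boundary D n) := fun k => m.withDensity fun ζ => ENNReal.ofReal (u k ζ)
    with hν
  have hνint : ∀ k (g : boundary D n → ℂ), ∫ ζ, g ζ ∂(ν k) = ∫ ζ, g ζ * (u k ζ : ℂ) ∂m := by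
    intro k g
    rw [hν, integral_withDensity_eq_integral_toReal_smul (by fun_prop (disch := exact huc k))
      (Filter.Eventually.of_forall fun ζ => ENNReal.ofReal_lt_top)]
    refine integral_congr_ae (Filter.Eventually.of_forall fun ζ => ?_)
    simp only [ENNReal.toReal_ofReal (hu0 k ζ), Complex.real_smul, mul_comm]
  have hνP : ∀ k, ∀ z ∈ domain D n, (((r k)⁻¹ : ℝ) : ℂ) • z ∈ domain D n →
      ∫ ζ : boundary D n, poissonKernel D z ζ ∂(ν k) = ((f ((r k : ℂ) • z)).re : ℂ) := by
    intro k z hz hzr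
    rw [hνint]
    exact hm.integral_poissonKernel hf (hr0 k) (hr1 k) hz hzr
  have huint : ∀ k, Integrable (u k) m := fun k =>
    (huc k).integrable_of_hasCompactSupport (HasCompactSupport.of_compactSpace _)
  have hmass : ∀ k, ν k Set.univ = ENNReal.ofReal (f 0).re := by
    intro k
    have h := hm.integral_poissonKernel hf (hr0 k) (hr1 k) (zero_mem_domain D n)
      (by rw [smul_zero]; exact zero_mem_domain D n)
    have hP : ∀ ζ : EuclideanSpace ℂ (Fin n), poissonKernel D 0 ζ = 1 := by
      intro ζ
      rw [poissonKernel, ← cauchyKernel_conj D 0 ζ, cauchyKernel_zero_left, cauchyKernel_zero_left]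
      simp
    simp only [hP, one_mul, smul_zero] at h
    rw [integral_complex_ofReal] at h
    rw [hν, withDensity_apply _ MeasurableSet.univ, Measure.restrict_univ,
      ← ofReal_integral_eq_lintegral_ofReal (huint k) (Filter.Eventually.of_forall (hu0 k))]
    exact congrArg _ (by exact_mod_cast h)
  have hfin : ∀ k, IsFiniteMeasure (ν k) := fun k =>
    ⟨by rw [hmass]; exact ENNReal.ofReal_lt_top⟩
  set N : ℕ → FiniteMeasure (boundary D n) := fun k => ⟨ν k, hfin k⟩ with hN
  have hcpt := isCompact_setOfPred_finiteMeasure_eq_of_compactSpace (boundary D n)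
    (f 0).re.toNNReal
  -- A limit along a free ultrafilter on `ℕ` replaces the choice of a convergent subsequence.
  obtain ⟨σ, -, hσ⟩ := hcpt.ultrafilter_le_nhds ((Filter.hyperfilter ℕ).map N) (by
    rw [Filter.le_principal_iff]
    refine Filter.Eventually.of_forall (p := fun k => (N k).mass = (f 0).re.toNNReal) fun k => ?_
    rw [FiniteMeasure.mass, FiniteMeasure.coeFn_def]
    change (ν k Set.univ).toNNReal = _
    rw [hmass]
    rfl)
  have hσ' : Filter.Tendsto N (Filter.hyperfilter ℕ) (nhds σ) := hσ
  rw [FiniteMeasure.tendsto_iff_forall_integral_rclike_tendsto ℂ] at hσ'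
  refine ⟨σ, inferInstance, fun z hz => ?_⟩
  have hlim1 := hσ' (BoundedContinuousFunction.mkOfCompact ⟨_, continuous_poissonKernel hz⟩)
  have hle : (Filter.hyperfilter ℕ : Filter ℕ) ≤ Filter.atTop := by
    rw [← Nat.cofinite_eq_atTop]; exact Filter.hyperfilter_le_cofinite
  have hlim2 : Filter.Tendsto (fun k => ((f ((r k : ℂ) • z)).re : ℂ)) (Filter.hyperfilter ℕ)
      (nhds ((f z).re : ℂ)) := by
    have h1 : Filter.Tendsto (fun k => (r k : ℂ) • z) Filter.atTop (nhds z) := by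
      have := ((Complex.continuous_ofReal.tendsto 1).comp hrlim).smul_const z
      simpa [Function.comp_def] using this
    have h2 : ContinuousAt f z :=
      hf.continuousOn.continuousAt ((isOpen_domain D n).mem_nhds hz)
    exact ((Complex.continuous_ofReal.tendsto _).comp
      ((Complex.continuous_re.tendsto _).comp (h2.tendsto.comp h1))).mono_left hle
  -- The formula for `ν k` needs `z / r k ∈ Ω`, which holds for large `k` because `Ω` is open.
  have hev : ∀ᶠ k in (Filter.hyperfilter ℕ : Filter ℕ),
      ∫ ζ : boundary D n, poissonKernel D z ζ ∂(ν k) = ((f ((r k : ℂ) • z)).re : ℂ) := by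
    have h1 : Filter.Tendsto (fun k => (((r k)⁻¹ : ℝ) : ℂ) • z) Filter.atTop (nhds z) := by
      have := ((Complex.continuous_ofReal.tendsto _).comp
        (hrlim.inv₀ one_ne_zero)).smul_const z
      simpa [Function.comp_def] using this
    filter_upwards [hle (h1.eventually ((isOpen_domain D n).mem_nhds hz))] with k hk
    exact hνP k z hz hk
  exact tendsto_nhds_unique hlim1 (hlim2.congr' (hev.mono fun k hk => hk.symm))

theorem HasCauchyFormula.exists_isClarkMeasure {m : Measure (boundary D n)} [IsFiniteMeasure m]
    (hm : HasCauchyFormula m) {b : EuclideanSpace ℂ (Fin n) → ℂ}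
    (hb : DifferentiableOn ℂ b (domain D n)) (hb_disc : ∀ z ∈ domain D n, ‖b z‖ < 1) {α : ℂ}
    (hα : ‖α‖ = 1) : ∃ σ : Measure (boundary D n), IsClarkMeasure D b α σ := by
  refine hm.exists_integral_poissonKernel_eq (f := fun z => (α + b z) / (α - b z)) (fun z hz => ?_)
    fun z hz => (re_cayley_pos hα (hb_disc z hz)).le
  have hne := sub_ne_zero_of_norm_lt hα (hb_disc z hz)
  have hbz := hb z hz
  fun_prop (disch := exact hne)

end Existence

/-! ### Averaging over a circle -/

/-- Fubini. It lets an integrand be replaced by its mean over a circle of symmetries of the measure,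
on the torus and on the sphere alike. -/
theorem integral_circleAverage {X : Type*} [TopologicalSpace X] [CompactSpace X]
    [SecondCountableTopology X] [MeasurableSpace X] [BorelSpace X] (μ : Measure X)
    [IsFiniteMeasure μ] {F : ℂ → X → ℂ}
    (hF : ContinuousOn (fun p : ℂ × X => F p.1 p.2) (Metric.sphere 0 1 ×ˢ Set.univ)) {I : ℂ}
    (hI : ∀ ω : ℂ, ‖ω‖ = 1 → ∫ x, F ω x ∂μ = I) :
    ∫ x, Real.circleAverage (fun ω => F ω x) 0 1 ∂μ = I := by
  have hmem : ∀ θ : ℝ, circleMap 0 1 θ ∈ Metric.sphere (0 : ℂ) 1 := fun θ =>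
    circleMap_mem_sphere _ zero_le_one _
  obtain ⟨K, hK⟩ := ((isCompact_sphere (0 : ℂ) 1).prod
    (isCompact_univ (X := X))).exists_bound_of_continuousOn hF
  have hc : Continuous fun p : ℝ × X => F (circleMap 0 1 p.1) p.2 :=
    hF.comp_continuous (f := fun p : ℝ × X => (circleMap 0 1 p.1, p.2)) (by fun_prop)
      fun p => ⟨hmem _, trivial⟩
  have hfin : IsFiniteMeasure (volume.restrict (Set.uIoc 0 (2 * Real.pi))) :=
    ⟨by simp [Set.uIoc]⟩
  have hint : Integrable (Function.uncurry fun θ x => F (circleMap 0 1 θ) x)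
      ((volume.restrict (Set.uIoc 0 (2 * Real.pi))).prod μ) :=
    Integrable.of_bound (C := K) hc.aestronglyMeasurable
      (Filter.Eventually.of_forall fun p => hK (circleMap 0 1 p.1, p.2) ⟨hmem _, trivial⟩)
  simp only [Real.circleAverage]
  rw [integral_smul, ← intervalIntegral_integral_swap hint]
  simp only [fun θ => hI _ (mem_sphere_zero_iff_norm.1 (hmem θ))]
  rw [intervalIntegral.integral_const, smul_smul, sub_zero,
    inv_mul_cancel₀ Real.two_pi_pos.ne', one_smul]

/-! ### The Cauchy formula for the polydisc -/

section Polydisc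

variable {n : ℕ}

/-- Haar measure on the product of circles, pushed forward; rotating coordinates is translation in
the group. -/
theorem exists_torusMeasure (n : ℕ) : ∃ m : Measure (boundary .polydisc n),
    IsProbabilityMeasure m ∧ ∀ c : Fin n → ℂ, (∀ j, ‖c j‖ = 1) →
      ∀ F : EuclideanSpace ℂ (Fin n) → ℂ, ContinuousOn F (boundary .polydisc n) →
        ∫ ζ : boundary .polydisc n, F (WithLp.toLp 2 fun j => c j *
          (ζ : EuclideanSpace ℂ (Fin n)) j) ∂m = ∫ ζ : boundary .polydisc n, F ζ ∂m := by
  let : MeasurableSpace Circle := borel Circle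
  have : BorelSpace Circle := ⟨rfl⟩
  let τ : (Fin n → Circle) → boundary .polydisc n := fun ξ =>
    ⟨WithLp.toLp 2 fun j => (ξ j : ℂ), fun j => Circle.norm_coe (ξ j)⟩
  have hτ : Continuous τ := by
    refine Continuous.subtype_mk ?_ _
    fun_prop
  let H : Measure (Fin n → Circle) := Measure.haarMeasure ⊤
  have : IsProbabilityMeasure H := ⟨Measure.haarMeasure_self⟩
  refine ⟨H.map τ, Measure.isProbabilityMeasure_map hτ.aemeasurable, fun c hc F hF => ?_⟩
  have hFc : Continuous fun ζ : boundary .polydisc n => F ζ :=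
    continuousOn_iff_continuous_domRestrict.1 hF
  have hrot : Continuous fun ζ : boundary .polydisc n =>
      F (WithLp.toLp 2 fun j => c j * (ζ : EuclideanSpace ℂ (Fin n)) j) := by
    refine hF.comp_continuous (by fun_prop) fun ζ j => ?_
    have := ζ.2 j
    simp [hc, this]
  rw [integral_map hτ.aemeasurable hrot.aestronglyMeasurable,
    integral_map hτ.aemeasurable hFc.aestronglyMeasurable]
  let c' : Fin n → Circle := fun j => ⟨c j, mem_sphere_zero_iff_norm.2 (hc j)⟩
  exact integral_mul_left_eq_self (μ := H) (fun ξ => F (τ ξ)) c'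

/-- The point with coordinates `z j` for `j ∈ S` and `x j` for `j ∉ S`. -/
def replaceCoords (S : Finset (Fin n)) (z x : EuclideanSpace ℂ (Fin n)) :
    EuclideanSpace ℂ (Fin n) :=
  WithLp.toLp 2 fun j => if j ∈ S then z j else x j

theorem continuous_replaceCoords (S : Finset (Fin n)) (z : EuclideanSpace ℂ (Fin n)) :
    Continuous (replaceCoords S z) := by
  refine (PiLp.continuous_toLp 2 _).comp (continuous_pi fun j => ?_)
  split_ifs <;> fun_prop

theorem smul_mem_polydisc {r : ℝ} (h0 : 0 < r) (h1 : r < 1) {x : EuclideanSpace ℂ (Fin n)}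
    (hx : ∀ j, ‖x j‖ ≤ 1) : (r : ℂ) • x ∈ domain .polydisc n := by
  intro j
  rw [PiLp.smul_apply, norm_smul]
  have := ofReal_norm_lt h0 h1
  nlinarith [hx j, norm_nonneg (x j), norm_nonneg (r : ℂ)]

/-- Cauchy's formula on the unit circle, in the form in which it is used on the torus. -/
theorem circleAverage_cauchy {φ : ℂ → ℂ} (hφ : DiffContOnCl ℂ φ (Metric.ball 0 1)) {z ξ : ℂ}
    (hz : ‖z‖ < 1) (hξ : ‖ξ‖ = 1) :
    Real.circleAverage (fun ω => 1 / (1 - z * conj (ω * ξ)) * φ ω) 0 1 = φ (z * conj ξ) := by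
  have hw : z * conj ξ ∈ Metric.ball (0 : ℂ) |1| := by
    rw [abs_one, mem_ball_zero_iff, norm_mul, RCLike.norm_conj, hξ, mul_one]
    exact hz
  rw [← abs_one] at hφ
  rw [← hφ.circleAverage_smul_div hw]
  refine Real.circleAverage_congr_sphere fun ω hω => ?_
  have hω' : ‖ω‖ = 1 := by simpa using hω
  have h1 : ω * conj ω = 1 := by rw [Complex.mul_conj, Complex.normSq_eq_norm_sq, hω']; simp
  have hne : 1 - z * conj (ω * ξ) ≠ 0 :=
    one_sub_mul_conj_ne_zero (by rwa [norm_mul, hω', hξ, mul_one, mul_one])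
  have h0 : ω ≠ 0 := by rintro rfl; simp at hω'
  have h2 : ω - z * conj ξ = ω * (1 - z * conj (ω * ξ)) := by
    rw [map_mul]; linear_combination (z * conj ξ) * h1
  simp only [sub_zero, smul_eq_mul]
  rw [h2, one_div, div_mul_eq_div_div, div_self h0, one_div]

theorem exists_hasCauchyFormula_polydisc (n : ℕ) : ∃ m : Measure (boundary .polydisc n),
    IsProbabilityMeasure m ∧ HasCauchyFormula m := by
  obtain ⟨m, hm, hinv⟩ := exists_torusMeasure n
  refine ⟨m, hm, fun g hg r h0 h1 z hz => ?_⟩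
  have hz' : ∀ j, ‖z j‖ < 1 := hz
  -- In `G S` the coordinates in `S` have already been integrated out by Cauchy's formula and
  -- replaced by those of `z`. The case `S = ∅` is the integrand of the claim, and `S = univ` is the
  -- constant `g(rz)`.
  set G : Finset (Fin n) → EuclideanSpace ℂ (Fin n) → ℂ := fun S x =>
    (∏ i ∈ Sᶜ, 1 / (1 - z i * conj (x i))) * g ((r : ℂ) • replaceCoords S z x) with hG
  have hmemΩ : ∀ (S : Finset (Fin n)) (x : EuclideanSpace ℂ (Fin n)), (∀ j, ‖x j‖ ≤ 1) →
      (r : ℂ) • replaceCoords S z x ∈ domain .polydisc n := by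
    intro S x hx
    refine smul_mem_polydisc h0 h1 fun j => ?_
    simp only [replaceCoords]
    split_ifs
    · exact (hz' j).le
    · exact hx j
  have hGc : ∀ S, ContinuousOn (G S) (boundary .polydisc n) := by
    intro S
    refine ContinuousOn.mul (continuousOn_finsetProd _ fun i _ => ?_) ?_
    · refine ContinuousOn.div continuousOn_const (by fun_prop) fun x hx => ?_
      have hx' : ‖x i‖ = 1 := hx i
      exact one_sub_mul_conj_ne_zero (by rw [hx', mul_one]; exact hz' i)
    · refine hg.continuousOn.comp
        ((continuous_replaceCoords S z).const_smul (r : ℂ)).continuousOn fun x hx =>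
          hmemΩ S x fun j => (hx j).le
  have key : ∀ S : Finset (Fin n), ∫ ζ : boundary .polydisc n, G S ζ ∂m =
      ∫ ζ : boundary .polydisc n, G ∅ ζ ∂m := by
    intro S
    induction S using Finset.induction_on with
    | empty => rfl
    | insert j S hj ih =>
      rw [← ih]
      -- Only the coordinate `j` is rotated. The mean over `ω` evaluates `φ` at `z j * conj (ζ j)`,
      -- and this factor turns `ζ j` into `z j`.
      set rot : ℂ → EuclideanSpace ℂ (Fin n) → EuclideanSpace ℂ (Fin n) := fun ω x =>
        WithLp.toLp 2 fun i => (if i = j then ω else 1) * x i with hrot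
      have hrotc : Continuous fun p : ℂ × EuclideanSpace ℂ (Fin n) => rot p.1 p.2 := by
        refine (PiLp.continuous_toLp 2 _).comp (continuous_pi fun i => ?_)
        split_ifs <;> fun_prop
      have havg := integral_circleAverage m (F := fun ω ζ => G S (rot ω ζ))
        (I := ∫ ζ : boundary .polydisc n, G S ζ ∂m)
        (by
          refine (hGc S).comp (hrotc.comp (f := fun p : ℂ × boundary .polydisc n =>
            (p.1, (p.2 : EuclideanSpace ℂ (Fin n)))) (by fun_prop)).continuousOn ?_
          rintro ⟨ω, ζ⟩ ⟨hω, -⟩ i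
          have hω' : ‖ω‖ = 1 := by simpa using hω
          have hζ : ‖(ζ : EuclideanSpace ℂ (Fin n)) i‖ = 1 := ζ.2 i
          simp only [hrot, norm_mul, hζ]
          split_ifs <;> simp [hω'])
        (fun ω hω => hinv (fun i => if i = j then ω else 1)
          (fun i => by split_ifs <;> simp [hω]) (G S) (hGc S))
      rw [← havg]
      refine integral_congr_ae (Filter.Eventually.of_forall fun ζ => ?_)
      obtain ⟨ζ, hζ⟩ := ζ
      have hζ' : ∀ i, ‖ζ i‖ = 1 := hζ
      set φ : ℂ → ℂ := fun ω => g ((r : ℂ) • replaceCoords S z (rot ω ζ)) with hφ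
      have hφd : DiffContOnCl ℂ φ (Metric.ball 0 1) := by
        refine DifferentiableOn.diffContOnCl fun ω hω => ?_
        have hω' : ‖ω‖ ≤ 1 := by
          rw [closure_ball _ one_ne_zero] at hω
          simpa using hω
        refine DifferentiableAt.differentiableWithinAt ?_
        have hmem := hmemΩ S (rot ω ζ) fun i => by
          simp only [hrot, norm_mul, hζ' i]
          split_ifs <;> simp [hω']
        refine DifferentiableAt.comp ω
          ((hg _ hmem).differentiableAt ((isOpen_domain _ n).mem_nhds hmem)) ?_
        rw [differentiableAt_euclidean]
        intro i
        simp only [replaceCoords, hrot, PiLp.smul_apply]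
        split_ifs <;> fun_prop
      have hsplit : ∀ ω, G S (rot ω ζ) = (∏ i ∈ (insert j S)ᶜ, 1 / (1 - z i * conj (ζ i))) *
          (1 / (1 - z j * conj (ω * ζ j)) * φ ω) := by
        intro ω
        simp only [hG]
        rw [← Finset.insert_erase (Finset.mem_compl.2 hj), Finset.prod_insert (by simp),
          Finset.compl_insert]
        have : ∀ i ∈ Sᶜ.erase j, 1 / (1 - z i * conj (rot ω ζ i)) = 1 / (1 - z i * conj (ζ i)) := by
          intro i hi
          simp [hrot, Finset.ne_of_mem_erase hi]
        rw [Finset.prod_congr rfl this]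
        simp [hrot, hφ]
        ring
      simp only [hsplit]
      have := Real.circleAverage_fun_smul (c := 0) (R := 1)
        (a := ∏ i ∈ (insert j S)ᶜ, 1 / (1 - z i * conj (ζ i)))
        (f := fun ω => 1 / (1 - z j * conj (ω * ζ j)) * φ ω)
      simp only [smul_eq_mul] at this
      rw [this, circleAverage_cauchy hφd (hz' j) (hζ' j)]
      simp only [hG, hφ]
      congr 3
      ext i
      have h1 : ζ j * conj (ζ j) = 1 := by
        rw [Complex.mul_conj, Complex.normSq_eq_norm_sq, hζ']; simp
      simp only [replaceCoords, hrot, Finset.mem_insert]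
      by_cases hij : i = j
      · subst hij
        simp only [true_or, if_true, hj, if_false]
        linear_combination (-z i) * h1
      · simp [hij]
  have h2 := key Finset.univ
  have h3 : ∀ ζ, G Finset.univ ζ = g ((r : ℂ) • z) := by
    intro ζ
    have : replaceCoords Finset.univ z ζ = z := by ext i; simp [replaceCoords]
    simp [hG, this]
  have h4 : ∀ ζ, G ∅ ζ = cauchyKernel .polydisc z ζ * g ((r : ℂ) • ζ) := by
    intro ζ
    have : replaceCoords ∅ z ζ = ζ := by ext i; simp [replaceCoords]
    simp [hG, this, cauchyKernel]
  simp only [h3, h4] at h2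
  rw [← h2]
  simp

end Polydisc

/-! ### The Cauchy formula for the ball -/

section Ball

variable {n : ℕ}

/-- Radial projection onto the unit sphere; the origin is sent to `e`. -/
def radialProj (e : boundary .ball n) (x : EuclideanSpace ℂ (Fin n)) : boundary .ball n :=
  ⟨if x = 0 then e else ((‖x‖⁻¹ : ℝ) : ℂ) • x, by
    split_ifs with h
    · exact e.2
    · change ‖_‖ = 1
      rw [norm_smul, Complex.norm_real, norm_inv, norm_norm,
        inv_mul_cancel₀ (norm_ne_zero_iff.2 h)]⟩

theorem measurable_radialProj (e : boundary .ball n) : Measurable (radialProj e) := by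
  refine Measurable.subtype_mk (Measurable.ite (measurableSet_singleton 0) measurable_const ?_)
  exact (Complex.measurable_ofReal.comp measurable_norm.inv).smul measurable_id

/-- Normalized volume on the ball is invariant under linear isometries, and radial projection
commutes with them off the null set `{0}`. -/
theorem exists_sphereMeasure (e : boundary .ball n) : ∃ m : Measure (boundary .ball n),
    IsProbabilityMeasure m ∧
      ∀ L : EuclideanSpace ℂ (Fin n) ≃ₗᵢ[ℂ] EuclideanSpace ℂ (Fin n),
      ∀ F : EuclideanSpace ℂ (Fin n) → ℂ, ContinuousOn F (boundary .ball n) →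
        ∫ ζ : boundary .ball n, F (L ζ) ∂m = ∫ ζ : boundary .ball n, F ζ ∂m := by
  have hnt : Nontrivial (EuclideanSpace ℂ (Fin n)) :=
    ⟨e, 0, fun h => by have h1 : ‖(e : EuclideanSpace ℂ (Fin n))‖ = 1 := e.2; simp [h] at h1⟩
  let := measureSpaceOfInnerProductSpace (E := EuclideanSpace ℂ (Fin n))
  set B : Set (EuclideanSpace ℂ (Fin n)) := Metric.ball 0 1 with hB
  set μ : Measure (EuclideanSpace ℂ (Fin n)) := ProbabilityTheory.cond volume B with hμ
  have hμp : IsProbabilityMeasure μ :=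
    ProbabilityTheory.cond_isProbabilityMeasure_of_finite
      (Metric.measure_ball_pos volume 0 one_pos).ne' measure_ball_lt_top.ne
  have hp := measurable_radialProj e
  have hL : ∀ L : EuclideanSpace ℂ (Fin n) ≃ₗᵢ[ℂ] EuclideanSpace ℂ (Fin n),
      MeasurePreserving L μ μ := by
    intro L
    let L' : EuclideanSpace ℂ (Fin n) ≃ₗᵢ[ℝ] EuclideanSpace ℂ (Fin n) :=
      ⟨L.toLinearEquiv.restrictScalars ℝ, L.norm_map⟩
    have h1 : MeasurePreserving L' := L'.measurePreserving
    have h2 := h1.restrict_preimage (s := B) Metric.isOpen_ball.measurableSet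
    have h3 : L' ⁻¹' B = B := by
      ext x
      simp only [hB, Set.mem_preimage, mem_ball_zero_iff, LinearIsometryEquiv.norm_map]
    rw [h3] at h2
    exact h2.smul_measure _
  have h0 : ∀ᵐ x ∂μ, x ≠ 0 := by
    refine Filter.Eventually.filter_mono
      (ProbabilityTheory.cond_absolutelyContinuous (μ := volume) (s := B)).ae_le ?_
    exact Measure.ae_ne volume 0
  refine ⟨μ.map (radialProj e), Measure.isProbabilityMeasure_map hp.aemeasurable,
    fun L F hF => ?_⟩
  have hFc : Continuous fun ζ : boundary .ball n => F ζ :=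
    continuousOn_iff_continuous_domRestrict.1 hF
  have hFL : Continuous fun ζ : boundary .ball n => F (L ζ) :=
    hF.comp_continuous (L.continuous.comp continuous_subtype_val) fun ζ => by
      change ‖_‖ = 1
      rw [L.norm_map]; exact ζ.2
  rw [integral_map hp.aemeasurable hFL.aestronglyMeasurable,
    integral_map hp.aemeasurable hFc.aestronglyMeasurable,
    ← (hL L).integral_comp L.toHomeomorph.measurableEmbedding (fun x => F (radialProj e x))]
  refine integral_congr_ae (h0.mono fun x hx => ?_)
  have hLx : L x ≠ 0 := by simpa using hx
  simp only [radialProj, hx, hLx, if_false, map_smul, L.norm_map]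

/-- Each unit vector is completed to an orthonormal basis, and one basis is mapped to the other. -/
theorem exists_linearIsometryEquiv_apply_eq {e e' : EuclideanSpace ℂ (Fin n)} (he : ‖e‖ = 1)
    (he' : ‖e'‖ = 1) :
    ∃ L : EuclideanSpace ℂ (Fin n) ≃ₗᵢ[ℂ] EuclideanSpace ℂ (Fin n), L e = e' := by
  have hpos : 0 < n := by
    rcases Nat.eq_zero_or_pos n with rfl | h
    · rw [Subsingleton.elim e 0, norm_zero] at he; exact absurd he zero_ne_one
    · exact h
  have hb : ∀ v : EuclideanSpace ℂ (Fin n), ‖v‖ = 1 →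
      ∃ B : OrthonormalBasis (Fin n) ℂ (EuclideanSpace ℂ (Fin n)), B ⟨0, hpos⟩ = v := by
    intro v hv
    have hon : Orthonormal ℂ (({⟨0, hpos⟩} : Set (Fin n)).domRestrict fun _ => v) := by
      refine ⟨fun _ => hv, fun i j hij => absurd (Subsingleton.elim i j) hij⟩
    obtain ⟨B, hB⟩ := hon.exists_orthonormalBasis_extension_of_card_eq (by simp)
    exact ⟨B, hB _ rfl⟩
  obtain ⟨B, hB⟩ := hb e he
  obtain ⟨B', hB'⟩ := hb e' he'
  exact ⟨B.equiv B' (Equiv.refl _), by rw [← hB, ← hB']; simp⟩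

/-- The unitary map that fixes `e` and multiplies the orthogonal complement of `e` by `ω`. -/
theorem exists_complementRotation {e : EuclideanSpace ℂ (Fin n)} (he : ‖e‖ = 1) {ω : ℂ}
    (hω : ‖ω‖ = 1) : ∃ L : EuclideanSpace ℂ (Fin n) ≃ₗᵢ[ℂ] EuclideanSpace ℂ (Fin n),
      ∀ x, L x = inner ℂ e x • e + ω • (x - inner ℂ e x • e) := by
  let T : EuclideanSpace ℂ (Fin n) →ₗ[ℂ] EuclideanSpace ℂ (Fin n) :=
    (innerSL ℂ e).toLinearMap.smulRight e +
      ω • (LinearMap.id - (innerSL ℂ e).toLinearMap.smulRight e)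
  have hT : ∀ x, T x = inner ℂ e x • e + ω • (x - inner ℂ e x • e) := fun x => rfl
  have hee : inner ℂ e e = (1 : ℂ) := by rw [inner_self_eq_norm_sq_to_K, he]; simp
  have hnorm : ∀ x, ‖T x‖ = ‖x‖ := by
    intro x
    have horth : inner ℂ (inner ℂ e x • e) (x - inner ℂ e x • e) = (0 : ℂ) := by
      rw [inner_smul_left, inner_sub_right, inner_smul_right, hee, mul_one, sub_self, mul_zero]
    have h1 := norm_add_sq_eq_norm_sq_add_norm_sq_of_inner_eq_zero _ _ horth
    have h2 := norm_add_sq_eq_norm_sq_add_norm_sq_of_inner_eq_zero (𝕜 := ℂ) (inner ℂ e x • e)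
      (ω • (x - inner ℂ e x • e)) (by rw [inner_smul_right, horth, mul_zero])
    rw [norm_smul ω, hω, one_mul, ← h1, ← hT, add_sub_cancel] at h2
    exact (mul_self_inj (norm_nonneg _) (norm_nonneg _)).1 h2
  exact ⟨LinearIsometry.toLinearIsometryEquiv ⟨T, hnorm⟩ rfl, hT⟩

end Ball

/-! ### Moments of a unitarily invariant measure on the sphere -/

section BallMoments

variable {n : ℕ}

/-- The function `ζ ↦ ⟪e, ζ⟫` on the sphere. -/
def innerFun (e : EuclideanSpace ℂ (Fin n)) : C(boundary .ball n, ℂ) :=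
  ⟨fun ζ => inner ℂ e (ζ : EuclideanSpace ℂ (Fin n)), by fun_prop⟩

theorem innerFun_apply (e : EuclideanSpace ℂ (Fin n)) (ζ : boundary .ball n) :
    innerFun e ζ = inner ℂ e (ζ : EuclideanSpace ℂ (Fin n)) := rfl

theorem innerFun_add_smul (a c : EuclideanSpace ℂ (Fin n)) (t : ℂ) :
    innerFun (a + conj t • c) = innerFun a + t • innerFun c := by
  ext ζ
  simp [innerFun_apply, mul_comm]

theorem star_innerFun_add_smul (a c : EuclideanSpace ℂ (Fin n)) (t : ℂ) :
    star (innerFun (a + t • c)) = star (innerFun a) + t • star (innerFun c) := by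
  ext ζ
  simp [innerFun_apply, mul_comm]

theorem norm_innerFun_le {e : EuclideanSpace ℂ (Fin n)} (he : ‖e‖ = 1) : ‖innerFun e‖ ≤ 1 := by
  refine (ContinuousMap.norm_le _ zero_le_one).2 fun ζ => ?_
  have hζ : ‖(ζ : EuclideanSpace ℂ (Fin n))‖ = 1 := ζ.2
  rw [innerFun_apply]
  exact (norm_inner_le_norm (𝕜 := ℂ) e (ζ : EuclideanSpace ℂ (Fin n))).trans
    (by rw [he, hζ, one_mul])

theorem sum_star_innerFun_mul_innerFun :
    ∑ j : Fin n, star (innerFun (EuclideanSpace.single j (1 : ℂ))) *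
      innerFun (EuclideanSpace.single j 1) = 1 := by
  ext ζ
  have hζ : ‖(ζ : EuclideanSpace ℂ (Fin n))‖ = 1 := ζ.2
  have h := EuclideanSpace.norm_sq_eq (ζ : EuclideanSpace ℂ (Fin n))
  simp only [ContinuousMap.sum_apply, ContinuousMap.mul_apply, ContinuousMap.star_apply,
    innerFun_apply, EuclideanSpace.inner_single_left, map_one, one_mul, ContinuousMap.one_apply]
  rw [hζ] at h
  have h2 : ∀ c : ℂ, star c * c = ((‖c‖ ^ 2 : ℝ) : ℂ) := fun c => by
    rw [← Complex.normSq_eq_norm_sq, ← Complex.mul_conj, mul_comm]; rfl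
  simp only [h2]
  rw [← Complex.ofReal_sum, ← h]
  simp

/-- Used to extract mixed moments from pure powers by comparing derivatives at `t = 0`. -/
theorem hasDerivAt_apply_pow_mul {A : Type*} [NormedCommRing A] [NormedAlgebra ℂ A]
    (Λ : A →L[ℂ] ℂ) (x y p : A) (l : ℕ) :
    HasDerivAt (fun t : ℂ => Λ ((x + t • y) ^ (l + 1) * p))
      (((l : ℂ) + 1) * Λ (x ^ l * y * p)) 0 := by
  have hx : HasDerivAt (fun t : ℂ => x + t • y) y 0 := by
    have := ((hasDerivAt_id (0 : ℂ)).smul_const y).const_add x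
    rwa [one_smul] at this
  have h := Λ.hasFDerivAt.comp_hasDerivAt (0 : ℂ) ((hx.fun_pow (l + 1)).mul_const p)
  have e : ((l + 1 : ℕ) : A) * (x + (0 : ℂ) • y) ^ (l + 1 - 1) * y * p =
      ((l : ℂ) + 1) • (x ^ l * y * p) := by
    rw [zero_smul, add_zero, Nat.add_sub_cancel, ← Nat.cast_add_one, Nat.cast_smul_eq_nsmul,
      nsmul_eq_mul]
    ring
  rw [e, map_smul, smul_eq_mul] at h
  exact h

/-- Invariance of a measure on the sphere under unitary maps. -/
def IsUnitarilyInvariant (m : Measure (boundary .ball n)) : Prop :=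
  ∀ L : EuclideanSpace ℂ (Fin n) ≃ₗᵢ[ℂ] EuclideanSpace ℂ (Fin n),
    ∀ F : EuclideanSpace ℂ (Fin n) → ℂ, ContinuousOn F (boundary .ball n) →
      ∫ ζ : boundary .ball n, F (L ζ) ∂m = ∫ ζ : boundary .ball n, F ζ ∂m

variable {m : Measure (boundary .ball n)} [IsProbabilityMeasure m]

/-- The moment `∫ |⟪e, ζ⟫|^{2k} dm(ζ)`. -/
def sphereMoment (m : Measure (boundary .ball n)) [IsFiniteMeasure m] (k : ℕ)
    (e : EuclideanSpace ℂ (Fin n)) : ℂ :=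
  integralMap m (star (innerFun e) ^ k * innerFun e ^ k)

theorem IsUnitarilyInvariant.sphereMoment_eq (hm : IsUnitarilyInvariant m) (k : ℕ)
    {e e' : EuclideanSpace ℂ (Fin n)} (he : ‖e‖ = 1) (he' : ‖e'‖ = 1) :
    sphereMoment m k e = sphereMoment m k e' := by
  obtain ⟨L, hL⟩ := exists_linearIsometryEquiv_apply_eq he' he
  have h := hm L (fun x => star (inner ℂ e x) ^ k * inner ℂ e x ^ k) (by fun_prop)
  refine h.symm.trans (integral_congr_ae (Filter.Eventually.of_forall fun ζ => ?_))
  simp only [← hL, LinearIsometryEquiv.inner_map_map]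
  rfl

/-- On the diagonal, homogeneity reduces to a unit vector, where the moment is independent of
direction; polarization does the rest. -/
theorem IsUnitarilyInvariant.integralMap_pow_mul_pow (hm : IsUnitarilyInvariant m) (k : ℕ)
    {e : EuclideanSpace ℂ (Fin n)} (he : ‖e‖ = 1) (z w : EuclideanSpace ℂ (Fin n)) :
    integralMap m (star (innerFun z) ^ k * innerFun w ^ k) =
      sphereMoment m k e * inner ℂ w z ^ k := by
  rw [← sub_eq_zero]
  refine polarization (Ω := Set.univ) isOpen_univ convex_univ
    (F := fun z w => integralMap m (star (innerFun z) ^ k * innerFun w ^ k) -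
      sphereMoment m k e * inner ℂ w z ^ k) (fun a c => ?_) (fun z _ => ?_) trivial trivial
  · simp only [innerFun_add_smul, star_innerFun_add_smul, inner_add_left, inner_add_right,
      inner_smul_left, inner_smul_right, Complex.conj_conj]
    fun_prop
  · by_cases hz : z = 0
    · subst hz
      have h0 : innerFun (0 : EuclideanSpace ℂ (Fin n)) = 0 := by ext ζ; simp [innerFun_apply]
      -- For `k = 0` one has `0 ^ 0 = 1`, and both terms are the total mass.
      rcases Nat.eq_zero_or_pos k with rfl | hk
      · simp [sphereMoment]
      · simp [h0, hk.ne']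
    · have hz' : ‖z‖ ≠ 0 := norm_ne_zero_iff.2 hz
      set v : EuclideanSpace ℂ (Fin n) := ((‖z‖⁻¹ : ℝ) : ℂ) • z with hv
      have hv1 : ‖v‖ = 1 := by
        rw [hv, norm_smul, Complex.norm_real, norm_inv, norm_norm, inv_mul_cancel₀ hz']
      have hzv : z = ((‖z‖ : ℝ) : ℂ) • v := by
        rw [hv, smul_smul, ← Complex.ofReal_mul, mul_inv_cancel₀ hz', Complex.ofReal_one, one_smul]
      have hX : innerFun z = ((‖z‖ : ℝ) : ℂ) • innerFun v := by
        ext ζ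
        conv_lhs => rw [hzv]
        simp [innerFun_apply]
      have h1 : star (innerFun z) ^ k * innerFun z ^ k =
          (((‖z‖ : ℝ) : ℂ) ^ k * ((‖z‖ : ℝ) : ℂ) ^ k) • (star (innerFun v) ^ k * innerFun v ^ k) := by
        rw [hX, star_smul, smul_pow, smul_pow, smul_mul_smul_comm]
        simp
      have h2 := hm.sphereMoment_eq k he hv1
      rw [sphereMoment, sphereMoment] at h2
      simp only [h1, map_smul, sphereMoment, h2, inner_self_eq_norm_sq_to_K, smul_eq_mul]
      simp only [Complex.coe_algebraMap]
      ring

/-- Differentiating the moment identity in both arguments in direction `v` expresses `∫ |⟪e,ζ⟫|^(2l)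
|⟪v,ζ⟫|² dm` through the next moment. Summing over the standard basis and using `∑ |ζ j|² = 1` gives
the recursion. -/
theorem IsUnitarilyInvariant.sphereMoment_succ (hm : IsUnitarilyInvariant m) (l : ℕ)
    {e : EuclideanSpace ℂ (Fin n)} (he : ‖e‖ = 1) :
    ((l : ℂ) + 1) * sphereMoment m l e = sphereMoment m (l + 1) e * (l + n) := by
  have h1 : ∀ z w v : EuclideanSpace ℂ (Fin n),
      integralMap m (star (innerFun z) ^ l * star (innerFun v) * innerFun w ^ (l + 1)) =
        sphereMoment m (l + 1) e * (inner ℂ w z ^ l * inner ℂ w v) := by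
    intro z w v
    have h := fun t : ℂ => hm.integralMap_pow_mul_pow (l + 1) he (z + t • v) w
    simp only [star_innerFun_add_smul, inner_add_right, inner_smul_right] at h
    have hd1 := hasDerivAt_apply_pow_mul (integralMap m) (star (innerFun z)) (star (innerFun v))
      (innerFun w ^ (l + 1)) l
    have hd2 : HasDerivAt (fun t : ℂ => sphereMoment m (l + 1) e *
        (inner ℂ w z + t * inner ℂ w v) ^ (l + 1))
        (sphereMoment m (l + 1) e * (((l + 1 : ℕ) : ℂ) * inner ℂ w z ^ l * inner ℂ w v)) 0 := by
      have hx : HasDerivAt (fun t : ℂ => inner ℂ w z + t * inner ℂ w v) (inner ℂ w v) 0 := by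
        simpa using ((hasDerivAt_id (0 : ℂ)).mul_const (inner ℂ w v)).const_add (inner ℂ w z)
      simpa using (hx.fun_pow (l + 1)).const_mul (sphereMoment m (l + 1) e)
    have heq := hd1.unique (by simpa only [h] using hd2)
    have hl : ((l : ℂ) + 1) ≠ 0 := by exact_mod_cast l.succ_ne_zero
    refine mul_left_cancel₀ hl (heq.trans ?_)
    push_cast
    ring
  have h2 : ∀ v : EuclideanSpace ℂ (Fin n),
      ((l : ℂ) + 1) * integralMap m (star (innerFun e) ^ l * innerFun e ^ l *
        (star (innerFun v) * innerFun v)) =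
      sphereMoment m (l + 1) e * (l * (inner ℂ v e * inner ℂ e v) + inner ℂ v v) := by
    intro v
    -- `innerFun` is antilinear in its index, so moving along `conj t • v` makes the integrand
    -- polynomial in `t`.
    have h := fun t : ℂ => h1 e (e + conj t • v) v
    have hee : inner ℂ e e = (1 : ℂ) := by rw [inner_self_eq_norm_sq_to_K, he]; simp
    simp only [innerFun_add_smul, inner_add_left, inner_smul_left, Complex.conj_conj, hee] at h
    have hd1 := hasDerivAt_apply_pow_mul (integralMap m) (innerFun e) (innerFun v)
      (star (innerFun e) ^ l * star (innerFun v)) l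
    have hd2 : HasDerivAt (fun t : ℂ => sphereMoment m (l + 1) e *
        ((1 + t * inner ℂ v e) ^ l * (inner ℂ e v + t * inner ℂ v v)))
        (sphereMoment m (l + 1) e * (l * inner ℂ v e * inner ℂ e v + inner ℂ v v)) 0 := by
      have hx : ∀ c d : ℂ, HasDerivAt (fun t : ℂ => c + t * d) d 0 := fun c d => by
        simpa using ((hasDerivAt_id (0 : ℂ)).mul_const d).const_add c
      simpa using (((hx 1 (inner ℂ v e)).fun_pow l).fun_mul
        (hx (inner ℂ e v) (inner ℂ v v))).const_mul (sphereMoment m (l + 1) e)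
    simp only [mul_comm _ ((innerFun _ + _) ^ (l + 1))] at h
    have heq := hd1.unique (by simpa only [h] using hd2)
    rw [mul_assoc (l : ℂ)] at heq
    rw [← heq]
    congr 2
    ring
  have h3 := Finset.sum_congr rfl fun (j : Fin n) (_ : j ∈ Finset.univ) =>
    h2 (EuclideanSpace.single j 1)
  rw [← Finset.mul_sum, ← map_sum, ← Finset.mul_sum, sum_star_innerFun_mul_innerFun, mul_one,
    ← Finset.mul_sum, Finset.sum_add_distrib, ← Finset.mul_sum] at h3
  have h4 : ∑ j : Fin n, inner ℂ (EuclideanSpace.single j (1 : ℂ)) e *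
      inner ℂ e (EuclideanSpace.single j (1 : ℂ)) = 1 := by
    have := EuclideanSpace.norm_sq_eq e
    rw [he] at this
    simp only [EuclideanSpace.inner_single_left, EuclideanSpace.inner_single_right, map_one,
      one_mul, Complex.mul_conj, Complex.normSq_eq_norm_sq]
    rw [← Complex.ofReal_sum, ← this]; simp
  rw [h4] at h3
  simpa [sphereMoment] using h3

/-- The recursion with `n = N + 1`, started at total mass `1`. The binomials are the Taylor
coefficients of `(1 - x)^(-(N+1))`, hence those of the Cauchy kernel. -/
theorem IsUnitarilyInvariant.choose_mul_sphereMoment {N : ℕ}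
    {m : Measure (boundary .ball (N + 1))} [IsProbabilityMeasure m]
    (hm : IsUnitarilyInvariant m) (k : ℕ) {e : EuclideanSpace ℂ (Fin (N + 1))} (he : ‖e‖ = 1) :
    ((k + N).choose N : ℂ) * sphereMoment m k e = 1 := by
  induction k with
  | zero => simp [sphereMoment, integralMap_apply]
  | succ k ih =>
    have h := hm.sphereMoment_succ k he
    have hc : ((k + N).choose N : ℂ) * (k + N + 1) = ((k + 1 + N).choose N : ℂ) * (k + 1) := by
      have := Nat.choose_mul_succ_eq (k + N) N
      have h1 : k + N + 1 - N = k + 1 := by omega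
      have h2 : k + N + 1 = k + 1 + N := by ring
      rw [h1] at this
      rw [← h2]
      exact_mod_cast this
    have hk : ((k : ℂ) + 1) ≠ 0 := by exact_mod_cast k.succ_ne_zero
    refine mul_left_cancel₀ hk ?_
    push_cast at h ⊢
    calc ((k : ℂ) + 1) * (((k + 1 + N).choose N : ℂ) * sphereMoment m (k + 1) e)
        = ((k + N).choose N : ℂ) * (sphereMoment m (k + 1) e * (k + (N + 1))) := by
          linear_combination (-sphereMoment m (k + 1) e) * hc
      _ = _ := by rw [← h]; linear_combination ((k : ℂ) + 1) * ih

theorem IsUnitarilyInvariant.integralMap_pow_mul_pow_of_ne (hm : IsUnitarilyInvariant m) {k j : ℕ}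
    (hkj : k ≠ j) (e : EuclideanSpace ℂ (Fin n)) :
    integralMap m (star (innerFun e) ^ j * innerFun e ^ k) = 0 := by
  -- The angle is chosen so that `ω ^ (k - j) = -1`: multiplication by the scalar `ω` then changes
  -- the sign of the integrand.
  set ω : Circle := Circle.exp (Real.pi / ((k : ℝ) - j)) with hω
  have hω1 : (ω : ℂ) ^ k * conj (ω : ℂ) ^ j = -1 := by
    have hne : ((k : ℂ) - j) ≠ 0 := sub_ne_zero.2 (by exact_mod_cast hkj)
    rw [← Circle.coe_inv_eq_conj, hω, ← Circle.exp_neg, Circle.coe_exp, Circle.coe_exp,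
      ← Complex.exp_nat_mul, ← Complex.exp_nat_mul, ← Complex.exp_add, ← Complex.exp_pi_mul_I]
    congr 1
    push_cast
    field_simp
    ring
  let L : EuclideanSpace ℂ (Fin n) ≃ₗᵢ[ℂ] EuclideanSpace ℂ (Fin n) :=
    LinearIsometry.toLinearIsometryEquiv
      ⟨(ω : ℂ) • LinearMap.id, fun x => by
        rw [LinearMap.smul_apply, norm_smul, Circle.norm_coe, one_mul, LinearMap.id_apply]⟩ rfl
  have hL : ∀ x, L x = (ω : ℂ) • x := fun x => rfl
  have h := hm L (fun x => star (inner ℂ e x) ^ j * inner ℂ e x ^ k) (by fun_prop)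
  have h2 : ∀ x, star (inner ℂ e (L x)) ^ j * inner ℂ e (L x) ^ k =
      -(star (inner ℂ e x) ^ j * inner ℂ e x ^ k) := by
    intro x
    rw [hL, inner_smul_right, star_mul', mul_pow, mul_pow]
    have : star (ω : ℂ) = conj (ω : ℂ) := rfl
    rw [this]
    linear_combination (star (inner ℂ e x) ^ j * inner ℂ e x ^ k) * hω1
  simp only [h2, integral_neg] at h
  change ∫ ζ : boundary .ball n, _ ∂m = 0
  exact self_eq_neg.1 h.symm

end BallMoments

/-! ### Cauchy's formula on the sphere by reduction to one variable -/

section BallCauchy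

/-- Convergence in the uniform norm is what permits termwise integration. -/
theorem exists_hasSum_smul_pow {X : Type*} [TopologicalSpace X] [CompactSpace X] {f : C(X, ℂ)}
    (hf : ‖f‖ ≤ 1) {a : ℕ → ℂ} (ha : Summable fun k => ‖a k‖) :
    ∃ S : C(X, ℂ), HasSum (fun k => a k • f ^ k) S ∧
      ∀ x, HasSum (fun k => a k * f x ^ k) (S x) := by
  have hs : Summable fun k => a k • f ^ k := by
    refine Summable.of_norm_bounded_eventually_nat ha ?_
    filter_upwards [Filter.eventually_gt_atTop 0] with k hk
    rw [norm_smul]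
    have h1 : ‖f ^ k‖ ≤ 1 := (norm_pow_le' f hk).trans (pow_le_one₀ (norm_nonneg _) hf)
    exact mul_le_of_le_one_right (norm_nonneg _) h1
  exact ⟨_, hs.hasSum, fun x => by
    simpa using hs.hasSum.mapL (ContinuousMap.evalCLM ℂ x)⟩

variable {N : ℕ} {m : Measure (boundary .ball (N + 1))} [IsProbabilityMeasure m]

/-- The one-variable form of the Cauchy formula on the sphere. -/
theorem IsUnitarilyInvariant.integral_slice (hm : IsUnitarilyInvariant m)
    {e : EuclideanSpace ℂ (Fin (N + 1))} (he : ‖e‖ = 1) {s : ℂ} (hs : ‖s‖ < 1) {R : ℝ}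
    (hR : 1 < R) {h : ℂ → ℂ} (hh : DifferentiableOn ℂ h (Metric.ball 0 R)) :
    ∫ ζ : boundary .ball (N + 1),
      1 / (1 - s * conj (inner ℂ e (ζ : EuclideanSpace ℂ (Fin (N + 1))))) ^ (N + 1) *
        h (inner ℂ e (ζ : EuclideanSpace ℂ (Fin (N + 1)))) ∂m = h s := by
  set a : ℕ → ℂ := fun k => (k.factorial : ℂ)⁻¹ * iteratedDeriv k h 0 with ha
  have hT : ∀ z : ℂ, ‖z‖ < R → HasSum (fun k => a k * z ^ k) (h z) := by
    intro z hz
    have := Complex.hasSum_taylorSeries_on_ball hh (z := z) (by simpa using hz)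
    have e : (fun k => a k * z ^ k) =
        fun k => (k.factorial : ℂ)⁻¹ • (z - 0) ^ k • iteratedDeriv k h 0 := by
      funext k
      simp only [ha, sub_zero, smul_eq_mul]; ring
    rwa [e]
  -- Since `R > 1`, the Taylor series converges at the point `1`, and summability in `ℂ` is
  -- absolute.
  have hasum : Summable fun k => ‖a k‖ := by
    have := (hT 1 (by simpa using hR)).summable
    simpa using this.norm
  have hbsum : Summable fun k => ‖((k + N).choose N : ℂ) * s ^ k‖ :=
    (hasSum_choose_mul_geometric_of_norm_lt_one N hs).summable.norm
  have hY : ‖star (innerFun e)‖ ≤ 1 := by rw [norm_star]; exact norm_innerFun_le he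
  obtain ⟨H, hH, hHx⟩ := exists_hasSum_smul_pow (norm_innerFun_le he) hasum
  obtain ⟨K, hK, hKx⟩ := exists_hasSum_smul_pow hY hbsum
  have hHe : ∀ ζ, H ζ = h (inner ℂ e (ζ : EuclideanSpace ℂ (Fin (N + 1)))) := by
    intro ζ
    refine (hHx ζ).unique (hT _ (lt_of_le_of_lt ?_ hR))
    exact (ContinuousMap.norm_coe_le_norm (innerFun e) ζ).trans (norm_innerFun_le he)
  have hKe : ∀ ζ, K ζ =
      1 / (1 - s * conj (inner ℂ e (ζ : EuclideanSpace ℂ (Fin (N + 1))))) ^ (N + 1) := by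
    intro ζ
    have hn : ‖conj (inner ℂ e (ζ : EuclideanSpace ℂ (Fin (N + 1))))‖ ≤ 1 :=
      (ContinuousMap.norm_coe_le_norm (star (innerFun e)) ζ).trans hY
    have hlt : ‖s * conj (inner ℂ e (ζ : EuclideanSpace ℂ (Fin (N + 1))))‖ < 1 := by
      rw [norm_mul]
      exact mul_lt_one_of_nonneg_of_lt_one_left (norm_nonneg _) hs hn
    refine (hKx ζ).unique ?_
    have := hasSum_choose_mul_geometric_of_norm_lt_one N hlt
    simp only [mul_pow, ← mul_assoc] at this
    exact this
  -- Expanding `K` leaves only the term `j = k`, where the binomial cancels the moment. So `K`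
  -- reproduces monomials, hence all of `h`.
  have hmom : ∀ k, integralMap m (K * innerFun e ^ k) = s ^ k := by
    intro k
    have h1 := (hK.mul_right (innerFun e ^ k)).mapL (integralMap m)
    refine h1.unique ?_
    have h2 : ∀ j, integralMap m ((((j + N).choose N : ℂ) * s ^ j) • star (innerFun e) ^ j *
        innerFun e ^ k) = if j = k then s ^ k else 0 := by
      intro j
      rw [smul_mul_assoc, map_smul, smul_eq_mul]
      split_ifs with hjk
      · subst hjk
        have := hm.choose_mul_sphereMoment j he
        rw [sphereMoment] at this
        linear_combination s ^ j * this
      · rw [hm.integralMap_pow_mul_pow_of_ne (Ne.symm hjk), mul_zero]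
    simp only [h2]
    exact hasSum_ite_eq k (s ^ k)
  have hfinal := (hH.mul_left K).mapL (integralMap m)
  simp only [mul_smul_comm, map_smul, hmom, smul_eq_mul] at hfinal
  rw [← hfinal.unique (hT s (hs.trans hR)), integralMap_apply]
  simp only [ContinuousMap.mul_apply, hHe, hKe]

/-- For `z = s • e` the kernel depends on `ζ` only through `⟪e, ζ⟫`. Averaging over rotations of the
complement of `e` replaces `g(rζ)` by its value at the projection onto `ℂ e`, by the mean value
property, which leaves `integral_slice`. -/
theorem IsUnitarilyInvariant.hasCauchyFormula (hm : IsUnitarilyInvariant m) :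
    HasCauchyFormula m := by
  intro g hg r h0 h1 z hz
  obtain ⟨e, he, s, hs, rfl⟩ : ∃ e : EuclideanSpace ℂ (Fin (N + 1)), ‖e‖ = 1 ∧
      ∃ s : ℂ, ‖s‖ < 1 ∧ z = s • e := by
    have hz' : ‖z‖ < 1 := hz
    by_cases h : z = 0
    · exact ⟨EuclideanSpace.single 0 1, by simp, 0, by simp, by rw [h, zero_smul]⟩
    · have hn : ‖z‖ ≠ 0 := norm_ne_zero_iff.2 h
      refine ⟨((‖z‖⁻¹ : ℝ) : ℂ) • z, ?_, ((‖z‖ : ℝ) : ℂ), by simpa using hz', ?_⟩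
      · rw [norm_smul, Complex.norm_real, norm_inv, norm_norm, inv_mul_cancel₀ hn]
      · rw [smul_smul, ← Complex.ofReal_mul, mul_inv_cancel₀ hn, Complex.ofReal_one, one_smul]
  have hee : inner ℂ e e = (1 : ℂ) := by rw [inner_self_eq_norm_sq_to_K, he]; simp
  have hC : ∀ ζ, cauchyKernel .ball (s • e) ζ = 1 / (1 - s * conj (inner ℂ e ζ)) ^ (N + 1) := by
    intro ζ
    rw [cauchyKernel, sum_mul_conj_eq_inner, inner_smul_right, inner_conj_symm]
  have hrball : ∀ x : EuclideanSpace ℂ (Fin (N + 1)), ‖x‖ ≤ 1 →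
      (r : ℂ) • x ∈ domain .ball (N + 1) := by
    intro x hx
    change ‖(r : ℂ) • x‖ < 1
    rw [norm_smul]
    exact mul_lt_one_of_nonneg_of_lt_one_left (norm_nonneg _) (ofReal_norm_lt h0 h1) hx
  -- For `|ω| = 1` this is unitary; for `|ω| ≤ 1` it does not increase norms, so `ω` may run over
  -- the whole disc, and `ω = 0` gives the projection onto `ℂ e`.
  set rot : ℂ → EuclideanSpace ℂ (Fin (N + 1)) → EuclideanSpace ℂ (Fin (N + 1)) := fun ω x =>
    inner ℂ e x • e + ω • (x - inner ℂ e x • e) with hrot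
  have hrotc : Continuous fun p : ℂ × EuclideanSpace ℂ (Fin (N + 1)) => rot p.1 p.2 := by
    simp only [hrot]; fun_prop
  have hrotn : ∀ ω x, ‖ω‖ ≤ 1 → ‖rot ω x‖ ≤ ‖x‖ := by
    intro ω x hω
    have horth : inner ℂ (inner ℂ e x • e) (x - inner ℂ e x • e) = (0 : ℂ) := by
      rw [inner_smul_left, inner_sub_right, inner_smul_right, hee, mul_one, sub_self, mul_zero]
    have h1 := norm_add_sq_eq_norm_sq_add_norm_sq_of_inner_eq_zero _ _ horth
    have h2 := norm_add_sq_eq_norm_sq_add_norm_sq_of_inner_eq_zero (𝕜 := ℂ) (inner ℂ e x • e)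
      (ω • (x - inner ℂ e x • e)) (by rw [inner_smul_right, horth, mul_zero])
    rw [add_sub_cancel] at h1
    have h3 : ‖ω • (x - inner ℂ e x • e)‖ ≤ ‖x - inner ℂ e x • e‖ := by
      rw [norm_smul]; exact mul_le_of_le_one_left (norm_nonneg _) hω
    refine abs_le_of_sq_le_sq' ?_ (norm_nonneg _) |>.2
    simp only [hrot]
    nlinarith [norm_nonneg (ω • (x - inner ℂ e x • e))]
  have hrote : ∀ ω x, inner ℂ e (rot ω x) = inner ℂ e x := by
    intro ω x
    simp only [hrot, inner_add_right, inner_smul_right, inner_sub_right, hee]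
    ring
  set F : EuclideanSpace ℂ (Fin (N + 1)) → ℂ := fun x =>
    cauchyKernel .ball (s • e) x * g ((r : ℂ) • x) with hF
  have hFc : ContinuousOn F (boundary .ball (N + 1)) := by
    refine continuousOn_iff_continuous_domRestrict.2 (Continuous.mul ?_
      (continuous_comp_dilation hg.continuousOn h0 h1))
    exact (cauchyMap .ball (s • e)).continuous.congr (cauchyMap_apply hz)
  have havg := integral_circleAverage m (F := fun ω ζ => F (rot ω ζ))
    (I := ∫ ζ : boundary .ball (N + 1), F ζ ∂m)
    (by
      refine hFc.comp (hrotc.comp (f := fun p : ℂ × boundary .ball (N + 1) =>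
        (p.1, (p.2 : EuclideanSpace ℂ (Fin (N + 1))))) (by fun_prop)).continuousOn ?_
      rintro ⟨ω, ζ⟩ ⟨hω, -⟩
      obtain ⟨L, hL⟩ := exists_complementRotation he (ω := ω) (by simpa using hω)
      change ‖inner ℂ e (ζ : EuclideanSpace ℂ (Fin (N + 1))) • e +
        ω • (ζ - inner ℂ e (ζ : EuclideanSpace ℂ (Fin (N + 1))) • e)‖ = 1
      rw [← hL, L.norm_map]
      exact ζ.2)
    (fun ω hω => by
      obtain ⟨L, hL⟩ := exists_complementRotation he hω
      rw [← hm L F hFc]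
      simp only [hL, hrot])
  change ∫ ζ : boundary .ball (N + 1), F ζ ∂m = _
  rw [← havg]
  have hmean : ∀ ζ : boundary .ball (N + 1), Real.circleAverage (fun ω => F (rot ω ζ)) 0 1 =
      1 / (1 - s * conj (inner ℂ e (ζ : EuclideanSpace ℂ (Fin (N + 1))))) ^ (N + 1) *
        g ((r : ℂ) • inner ℂ e (ζ : EuclideanSpace ℂ (Fin (N + 1))) • e) := by
    intro ζ
    have hζ : ‖(ζ : EuclideanSpace ℂ (Fin (N + 1)))‖ = 1 := ζ.2
    have hφ : DiffContOnCl ℂ (fun ω => g ((r : ℂ) • rot ω ζ)) (Metric.ball 0 |1|) := by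
      refine DifferentiableOn.diffContOnCl fun ω hω => ?_
      have hω' : ‖ω‖ ≤ 1 := by
        rw [abs_one, closure_ball _ one_ne_zero] at hω
        simpa using hω
      refine DifferentiableAt.differentiableWithinAt ?_
      have hmem := hrball (rot ω ζ) ((hrotn ω ζ hω').trans hζ.le)
      refine DifferentiableAt.comp ω (f := fun ω => (r : ℂ) • rot ω ζ)
        ((hg _ hmem).differentiableAt ((isOpen_domain _ _).mem_nhds hmem)) ?_
      simp only [hrot]
      fun_prop
    have h2 := hφ.circleAverage
    have h3 := Real.circleAverage_fun_smul (c := 0) (R := 1)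
      (a := cauchyKernel .ball (s • e) (ζ : EuclideanSpace ℂ (Fin (N + 1))))
      (f := fun ω => g ((r : ℂ) • rot ω ζ))
    simp only [smul_eq_mul] at h3
    have h4 : ∀ ω, F (rot ω ζ) = cauchyKernel .ball (s • e) (ζ : EuclideanSpace ℂ (Fin (N + 1))) *
        g ((r : ℂ) • rot ω ζ) := by
      intro ω
      simp only [hF, hC, hrote]
    simp only [h4]
    rw [h3, h2, hC]
    simp [hrot]
  simp only [hmean]
  -- The slice `c ↦ g(r c e)` is holomorphic for `|c| < 1/r`, a disc strictly larger than the unit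
  -- disc.
  have hR : 1 < r⁻¹ := (one_lt_inv₀ h0).2 h1
  refine hm.integral_slice he hs hR (h := fun c => g ((r : ℂ) • c • e)) fun c hc => ?_
  have hc' : ‖c‖ < r⁻¹ := by simpa using hc
  have hmem : (r : ℂ) • c • e ∈ domain .ball (N + 1) := by
    change ‖(r : ℂ) • c • e‖ < 1
    rw [norm_smul, norm_smul, he, mul_one, Complex.norm_real, Real.norm_of_nonneg h0.le]
    calc r * ‖c‖ < r * r⁻¹ := by gcongr
      _ = 1 := mul_inv_cancel₀ h0.ne'
  refine DifferentiableAt.differentiableWithinAt ?_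
  exact DifferentiableAt.comp c (f := fun c : ℂ => (r : ℂ) • c • e)
    ((hg _ hmem).differentiableAt ((isOpen_domain _ _).mem_nhds hmem)) (by fun_prop)

end BallCauchy

theorem exists_hasCauchyFormula (D : DomainKind) {n : ℕ} (hn : n ≠ 0) :
    ∃ m : Measure (boundary D n), IsProbabilityMeasure m ∧ HasCauchyFormula m := by
  cases D with
  | ball =>
    obtain ⟨N, rfl⟩ := Nat.exists_eq_succ_of_ne_zero hn
    obtain ⟨m, hm, hinv⟩ := exists_sphereMeasure (n := N + 1)
      ⟨EuclideanSpace.single 0 1, by simp [boundary]⟩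
    have hinv' : IsUnitarilyInvariant m := hinv
    exact ⟨m, hm, hinv'.hasCauchyFormula⟩
  | polydisc => exact exists_hasCauchyFormula_polydisc n

end Clark

end

open Clark in
theorem mainTheorem2 (D : DomainKind) (n : ℕ) (hn : 2 ≤ n)
    (b : EuclideanSpace ℂ (Fin n) → ℂ)
    (hb : DifferentiableOn ℂ b (domain D n))
    (hb_disc : ∀ z ∈ domain D n, ‖b z‖ < 1)
    (hb_nonconst : ∃ z ∈ domain D n, ∃ w ∈ domain D n, b z ≠ b w)
    (α : ℂ) (hα : ‖α‖ = 1) :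
    ∃ _ : Fact (dbrKernel D b).PosSemidef,
      (∃ σ : Measure (boundary D n), IsClarkMeasure D b α σ) ∧
      ∀ (σ : Measure (boundary D n)) [IsFiniteMeasure σ], IsClarkMeasure D b α σ →
        ∃! U : DBRSpace D b ≃ₗᵢ[ℂ] H2 D σ, ∀ w : domain D n,
          (U (dbrKernelFun D b w) : Lp ℂ 2 σ) = (1 - α * conj (b w)) • cauchyL2 D σ w := by
  obtain ⟨m, hm, hC⟩ := exists_hasCauchyFormula D (n := n) (by omega)
  obtain ⟨σ, hσ⟩ := hC.exists_isClarkMeasure hb hb_disc hα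
  have hfin := hσ.1
  -- Positivity in (a) comes from the Clark measure just found, so (b) is settled before (a).
  have hpos : Fact (dbrKernel D b).PosSemidef := ⟨dbrKernel_posSemidef hb hb_disc hα hσ⟩
  exact ⟨hpos, ⟨σ, hσ⟩, fun σ _ hσ => existsUnique_clarkUnitary hb hb_disc hα hσ⟩
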